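/- Let $p$ be a prime and let $T$ be the rooted tree whose vertices are the finite words in an alphabet $X=\{x_1,\dots,x_p\}$, where the descendants of a word $u$ are the words $ux$ with $x\in X$. Let $G$ be the $p$-Basilica group, that is, the subgroup of $\mathrm{Aut}(T)$ generated by the automorphisms $a$ and $b$ defined recursively by $$a=(1,\dots,1,b),\qquad b=(1,\dots,1,a)\,\sigma,\qquad \sigma=(x_1\,x_2\,\cdots\,x_p).$$ Explicitly, both fix the empty word and, for every word $v$, $a(x_iv)=x_iv$ and $b(x_iv)=x_{i+1}v$ for $i<p$, while $a(x_pv)=x_p\,b(v)$ and $b(x_pv)=x_1\,a(v)$. For $n\ge 0$ let $\mathrm{St}_G(n)$ be the subgroup of those elements of $G$ that fix all words of length $n$. Then: 1. $G$ has the $p$-congruence subgroup property: every normal subgroup of $G$ of $p$-power index contains $\mathrm{St}_G(n)$ for some $n$. 2. $G$ does not have the congruence subgroup property: some subgroup of finite index in $G$ contains no $\mathrm{St}_G(n)$. 3. $G$ does not have the weak congruence subgroup property: some subgroup of finite index in $G$ contains no derived subgroup $\mathrm{St}_G(n)'$. More precisely, for every prime $q\neq p$ there is a normal subgroup $N$ of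 $G$ such that $G/N$ is isomorphic to the Heisenberg group $H_3(q)$ of upper unitriangular $3\times 3$ matrices over $\mathbb{Z}/q\mathbb{Z}$, and $\mathrm{St}_G(n)'\not\le N$ for all $n$. -/

import Mathlib

namespace PBasilica

/-- The `p`-adic tree: the vertices are the words in an alphabet with `p` letters, the root is the
empty word, and the descendants of a word `u` are the words `ux` with `x` a letter. -/
def tree (p : ℕ) : SimpleGraph (List (Fin p)) where
  Adj u v := (∃ x, v = u ++ [x]) ∨ (∃ x, u = v ++ [x])
  symm := ⟨fun _ _ h => h.symm⟩
  loopless := ⟨fun u h => by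
    rcases h with ⟨x, h⟩ | ⟨x, h⟩ <;> simpa using congrArg List.length h⟩

/-- The group of automorphisms of the `p`-adic tree, as a graph, under composition. -/
abbrev TreeAut (p : ℕ) : Type := tree p ≃g tree p

/-- A bijection on words which, like its inverse, maps descendants to descendants is an
automorphism of the tree. -/
def treeAutOfInverse {p : ℕ} (f g : List (Fin p) → List (Fin p))
    (hgf : Function.LeftInverse g f) (hfg : Function.RightInverse g f)
    (hf : ∀ u x, ∃ y, f (u ++ [x]) = f u ++ [y]) (hg : ∀ u x, ∃ y, g (u ++ [x]) = g u ++ [y]) :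
    TreeAut p where
  toFun := f
  invFun := g
  left_inv := hgf
  right_inv := hfg
  map_rel_iff' := by
    have key : ∀ u v, (∃ x, f v = f u ++ [x]) ↔ ∃ x, v = u ++ [x] := by
      intro u v
      constructor
      · rintro ⟨x, hx⟩
        obtain ⟨y, hy⟩ := hg (f u) x
        rw [← hx, hgf, hgf] at hy
        exact ⟨y, hy⟩
      · rintro ⟨x, rfl⟩
        exact hf u x
    intro u v
    exact or_congr (key u v) (key v u)

mutual
/-- The action of `a = (1, …, 1, b)` on words: `a` fixes the first letter, and its section is `b`
at the last letter of the alphabet and trivial at the other letters. -/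
def aFun {p : ℕ} : List (Fin p) → List (Fin p)
  | [] => []
  | x :: v => x :: (if x.val + 1 = p then bFun v else v)
/-- The action of `b = (1, …, 1, a) σ` on words: `b` moves the first letter by the `p`-cycle
`σ = (0 1 … p-1)`, and its section is `a` at the last letter of the alphabet and trivial at the
other letters. -/
def bFun {p : ℕ} : List (Fin p) → List (Fin p)
  | [] => []
  | x :: v => finRotate p x :: (if x.val + 1 = p then aFun v else v)
end

mutual
/-- The inverse of `aFun`. -/
def aInv {p : ℕ} : List (Fin p) → List (Fin p)
  | [] => []
  | x :: v => x :: (if x.val + 1 = p then bInv v else v)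
/-- The inverse of `bFun`. -/
def bInv {p : ℕ} : List (Fin p) → List (Fin p)
  | [] => []
  | y :: v => (finRotate p).symm y ::
      (if ((finRotate p).symm y).val + 1 = p then aInv v else v)
end

theorem inv_fun {p : ℕ} (u : List (Fin p)) : aInv (aFun u) = u ∧ bInv (bFun u) = u := by
  induction u with
  | nil => simp [aFun, bFun, aInv, bInv]
  | cons x v ih =>
    by_cases h : x.val + 1 = p <;>
      simp only [aFun, bFun, aInv, bInv, h, if_true, if_false, ih.1, ih.2, Equiv.symm_apply_apply,
        and_self]

theorem fun_inv {p : ℕ} (u : List (Fin p)) : aFun (aInv u) = u ∧ bFun (bInv u) = u := by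
  induction u with
  | nil => simp [aFun, bFun, aInv, bInv]
  | cons x v ih =>
    constructor
    · by_cases h : x.val + 1 = p <;> simp [aFun, aInv, h, ih.2]
    · by_cases h : ((finRotate p).symm x).val + 1 = p <;>
        simp only [bFun, bInv, h, if_true, if_false, ih.1, Equiv.apply_symm_apply]

theorem fun_append {p : ℕ} (u : List (Fin p)) (x : Fin p) :
    (∃ y, aFun (u ++ [x]) = aFun u ++ [y]) ∧ ∃ y, bFun (u ++ [x]) = bFun u ++ [y] := by
  induction u with
  | nil => simp [aFun, bFun]
  | cons z v ih =>
    by_cases h : z.val + 1 = p <;> simp [aFun, bFun, h, ih.1, ih.2]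

theorem inv_append {p : ℕ} (u : List (Fin p)) (x : Fin p) :
    (∃ y, aInv (u ++ [x]) = aInv u ++ [y]) ∧ ∃ y, bInv (u ++ [x]) = bInv u ++ [y] := by
  induction u with
  | nil => simp [aInv, bInv]
  | cons z v ih =>
    constructor
    · by_cases h : z.val + 1 = p <;> simp [aInv, h, ih.2]
    · simp only [List.cons_append, bInv, List.cons.injEq, true_and]
      split_ifs
      · exact ih.1
      · exact ⟨x, rfl⟩

/-- The automorphism `a = (1, …, 1, b)` of the `p`-adic tree. -/
def a (p : ℕ) : TreeAut p :=
  treeAutOfInverse aFun aInv (fun u => (inv_fun u).1) (fun u => (fun_inv u).1)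
    (fun u x => (fun_append u x).1) (fun u x => (inv_append u x).1)

/-- The automorphism `b = (1, …, 1, a) σ` of the `p`-adic tree. -/
def b (p : ℕ) : TreeAut p :=
  treeAutOfInverse bFun bInv (fun u => (inv_fun u).2) (fun u => (fun_inv u).2)
    (fun u x => (fun_append u x).2) (fun u x => (inv_append u x).2)

/-- The `p`-Basilica group, generated by `a` and `b`. -/
def basilica (p : ℕ) : Subgroup (TreeAut p) := Subgroup.closure {a p, b p}

/-- The stabiliser `St(n)` of the `n`th level: the automorphisms that fix every word of
length `n`. -/
def levelStabilizer (p n : ℕ) : Subgroup (TreeAut p) where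
  carrier := {f | ∀ u : List (Fin p), u.length = n → f u = u}
  one_mem' := fun _ _ => rfl
  mul_mem' := fun {f g} hf hg u hu => by
    change f (g u) = u
    rw [hg u hu, hf u hu]
  inv_mem' := fun {f} hf u hu => by
    change f.symm u = u
    rw [RelIso.symm_apply_eq, hf u hu]

/-- The level stabiliser `St_G(n) = St(n) ∩ G`, as a subgroup of `G`. -/
def levelStabilizerIn {p : ℕ} (G : Subgroup (TreeAut p)) (n : ℕ) : Subgroup G :=
  (levelStabilizer p n).subgroupOf G

/-- The congruence subgroup property: every subgroup of finite index contains some level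
stabiliser. -/
def HasCongruenceSubgroupProperty {p : ℕ} (G : Subgroup (TreeAut p)) : Prop :=
  ∀ H : Subgroup G, H.FiniteIndex → ∃ n : ℕ, levelStabilizerIn G n ≤ H

/-- The `p`-congruence subgroup property: every normal subgroup of `p`-power index contains some
level stabiliser. -/
def HasPCongruenceSubgroupProperty {p : ℕ} (G : Subgroup (TreeAut p)) : Prop :=
  ∀ N : Subgroup G, N.Normal → (∃ k : ℕ, N.index = p ^ k) → ∃ n : ℕ, levelStabilizerIn G n ≤ N

/-- The weak congruence subgroup property: every subgroup of finite index contains the derived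
subgroup of some level stabiliser. -/
def HasWeakCongruenceSubgroupProperty {p : ℕ} (G : Subgroup (TreeAut p)) : Prop :=
  ∀ H : Subgroup G, H.FiniteIndex →
    ∃ n : ℕ, ⁅levelStabilizerIn G n, levelStabilizerIn G n⁆ ≤ H

/-- The Heisenberg group over `R`: the upper triangular `3 × 3` matrices over `R` with ones on the
diagonal. -/
def heisenberg (R : Type*) [CommRing R] : Subgroup (Matrix.SpecialLinearGroup (Fin 3) R) where
  carrier := {M | (∀ i, M i i = 1) ∧ ∀ i j, j < i → M i j = 0}
  one_mem' := by
    refine ⟨fun i => by simp, fun i j h => ?_⟩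
    simp [h.ne']
  mul_mem' := by
    rintro M N ⟨hM, hM'⟩ ⟨hN, hN'⟩
    have h1 := hM' 1 0 (by decide)
    have h2 := hM' 2 0 (by decide)
    have h3 := hM' 2 1 (by decide)
    have k1 := hN' 1 0 (by decide)
    have k2 := hN' 2 0 (by decide)
    have k3 := hN' 2 1 (by decide)
    constructor
    · intro i
      fin_cases i <;>
        simp [Matrix.mul_apply, Fin.sum_univ_three, hM, hN, h1, h2, h3, k1, k2, k3]
    · intro i j h
      fin_cases i <;> fin_cases j <;> first
        | exact absurd h (by decide)
        | simp [Matrix.mul_apply, Fin.sum_univ_three, hM, hN, h1, h2, h3, k1, k2, k3]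
  inv_mem' := by
    rintro M ⟨hM, hM'⟩
    have h1 := hM' 1 0 (by decide)
    have h2 := hM' 2 0 (by decide)
    have h3 := hM' 2 1 (by decide)
    constructor
    · intro i
      fin_cases i <;>
        simp [Matrix.SpecialLinearGroup.coe_inv, Matrix.adjugate_fin_three, hM, h1, h2, h3]
    · intro i j h
      fin_cases i <;> fin_cases j <;> first
        | exact absurd h (by decide)
        | simp [Matrix.SpecialLinearGroup.coe_inv, Matrix.adjugate_fin_three, hM, h1, h2, h3]

end PBasilica

-- Everything rests on a homomorphism χ from G to the integral Heisenberg group with a ↦ α, b ↦ β.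
-- To see that it exists, take the subgroup `heisGraph` generated by the pairs (a, α), (b, β) and
-- show that it is the graph of a function. If the first-level sections of (g, (x, y, z)) are (g_i,
-- (x_i, y_i, z_i)), then g moves the letter i to (i + y) mod p, and x_i = ⌊(i + y)/p⌋, x = ∑ y_i, z
-- = ∑ (p (x_i y_i - z_i) - (i - (p - 1)) y_i) (`exists_isSections`). If g fixes a letter, then y =
-- p x_i there. Descending the tree, an element fixing level 3n has coordinates divisible by p ^ n
-- (`pow_dvd_of_mem_wordStabilizer`), so g = 1 forces all coordinates to vanish.
--
-- Reducing χ mod q gives the quotients H_3(q). The powers a^(p^n), b^(p^n) lie in St_G(n), and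
-- their commutator has corner entry p^(2n), which is nonzero mod q. This refutes the weak
-- congruence property, hence also the full one.
--
-- For the p-congruence property, a normal N of index p^k contains all p^k-th powers; in particular
-- it is nontrivial, since a has infinite order. As G is weakly branch over G', N contains the
-- copies of G'' below all words of some length j (`exists_derivedTwo_le_comap_atWord`). It remains
-- to descend from G to these copies, absorbing the errors in p^k-th powers. The quotient G/G' is
-- ℤ², detected by x and y. An element of G' has first-level sections in G' up to powers of b, with
-- exponents of sum zero. At the bottom, G' is generated by [a, b] modulo the elements whose copies
-- at all letters lie in G'', and z detects the exponent of [a, b]. In each case fixing a deep level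
-- makes the exponents divisible by a high power of p.

namespace PBasilica

open scoped commutatorElement

-- The Heisenberg group in coordinates

/-- The Heisenberg group over `R` in coordinates: the triple `⟨x, y, z⟩` stands for the matrix
with entries `x`, `y` above the diagonal and `z` in the corner. -/
@[ext]
structure Heis (R : Type*) where
  x : R
  y : R
  z : R

namespace Heis

variable {R S : Type*} [CommRing R] [CommRing S]

instance : Mul (Heis R) := ⟨fun g h => ⟨g.x + h.x, g.y + h.y, g.z + h.z + g.x * h.y⟩⟩
instance : One (Heis R) := ⟨⟨0, 0, 0⟩⟩
instance : Inv (Heis R) := ⟨fun g => ⟨-g.x, -g.y, g.x * g.y - g.z⟩⟩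

@[simp] theorem mul_x (g h : Heis R) : (g * h).x = g.x + h.x := rfl
@[simp] theorem mul_y (g h : Heis R) : (g * h).y = g.y + h.y := rfl
@[simp] theorem mul_z (g h : Heis R) : (g * h).z = g.z + h.z + g.x * h.y := rfl
@[simp] theorem one_x : (1 : Heis R).x = 0 := rfl
@[simp] theorem one_y : (1 : Heis R).y = 0 := rfl
@[simp] theorem one_z : (1 : Heis R).z = 0 := rfl
@[simp] theorem inv_x (g : Heis R) : g⁻¹.x = -g.x := rfl
@[simp] theorem inv_y (g : Heis R) : g⁻¹.y = -g.y := rfl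
@[simp] theorem inv_z (g : Heis R) : g⁻¹.z = g.x * g.y - g.z := rfl

instance : Group (Heis R) :=
  Group.ofLeftAxioms
    (fun g h k => by ext <;> simp <;> ring)
    (fun g => by ext <;> simp)
    (fun g => by ext <;> simp)

/-- The first generator of the Heisenberg group. -/
def α : Heis R := ⟨1, 0, 0⟩

/-- The second generator of the Heisenberg group. -/
def β : Heis R := ⟨0, 1, 0⟩

@[simp] theorem α_x : (α : Heis R).x = 1 := rfl
@[simp] theorem α_y : (α : Heis R).y = 0 := rfl
@[simp] theorem α_z : (α : Heis R).z = 0 := rfl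
@[simp] theorem β_x : (β : Heis R).x = 0 := rfl
@[simp] theorem β_y : (β : Heis R).y = 1 := rfl
@[simp] theorem β_z : (β : Heis R).z = 0 := rfl

/-- The first coordinate, as a homomorphism. -/
def xHom (R : Type*) [CommRing R] : Heis R →* Multiplicative R where
  toFun g := Multiplicative.ofAdd g.x
  map_one' := rfl
  map_mul' _ _ := rfl

/-- The second coordinate, as a homomorphism. -/
def yHom (R : Type*) [CommRing R] : Heis R →* Multiplicative R where
  toFun g := Multiplicative.ofAdd g.y
  map_one' := rfl
  map_mul' _ _ := rfl

theorem zpow_x (g : Heis R) (n : ℤ) : (g ^ n).x = n * g.x := by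
  have h := congrArg Multiplicative.toAdd (map_zpow (xHom R) g n)
  simpa [xHom] using h

theorem zpow_y (g : Heis R) (n : ℤ) : (g ^ n).y = n * g.y := by
  have h := congrArg Multiplicative.toAdd (map_zpow (yHom R) g n)
  simpa [yHom] using h

theorem pow_x (g : Heis R) (n : ℕ) : (g ^ n).x = n * g.x := by
  simpa using zpow_x g n

theorem pow_y (g : Heis R) (n : ℕ) : (g ^ n).y = n * g.y := by
  simpa using zpow_y g n

theorem zpow_z_of_x_eq_zero {g : Heis R} (hg : g.x = 0) (n : ℤ) : (g ^ n).z = n * g.z := by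
  induction n with
  | zero => simp
  | succ n ih => rw [zpow_add_one, mul_z, ih, zpow_x, hg]; push_cast; ring
  | pred n ih => rw [zpow_sub_one, mul_z, ih, zpow_x, inv_z, hg]; push_cast; ring

theorem zpow_z_of_y_eq_zero {g : Heis R} (hg : g.y = 0) (n : ℤ) : (g ^ n).z = n * g.z := by
  induction n with
  | zero => simp
  | succ n ih => rw [zpow_add_one, mul_z, ih, hg]; push_cast; ring
  | pred n ih => rw [zpow_sub_one, mul_z, ih, inv_y, inv_z, hg]; push_cast; ring

theorem commutatorElement_eq (g h : Heis R) : ⁅g, h⁆ = ⟨0, 0, g.x * h.y - h.x * g.y⟩ := by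
  ext <;> simp [commutatorElement_def]; ring

theorem eq_of_mem_commutator {g : Heis R} {H K : Subgroup (Heis R)} (hg : g ∈ ⁅H, K⁆) :
    g.x = 0 ∧ g.y = 0 := by
  let L : Subgroup (Heis R) := (xHom R).ker ⊓ (yHom R).ker
  have hL : ⁅H, K⁆ ≤ L := by
    rw [Subgroup.commutator_le]
    intro g _ h _
    rw [commutatorElement_eq]
    exact ⟨rfl, rfl⟩
  have := hL hg
  exact ⟨this.1, this.2⟩

/-- The group has nilpotency class two. This places G'' in the kernel of χ. -/
theorem commutator_commutator_eq_bot (H K : Subgroup (Heis R)) : ⁅⁅H, K⁆, ⁅H, K⁆⁆ = ⊥ := by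
  rw [eq_bot_iff, Subgroup.commutator_le]
  intro g hg h hh
  rw [commutatorElement_eq, (eq_of_mem_commutator hg).1, (eq_of_mem_commutator hh).1]
  simp only [zero_mul, sub_zero]
  rfl

/-- A homomorphism of rings induces a homomorphism of Heisenberg groups. -/
def map (f : R →+* S) : Heis R →* Heis S where
  toFun g := ⟨f g.x, f g.y, f g.z⟩
  map_one' := by ext <;> simp
  map_mul' g h := by ext <;> simp

theorem map_surjective {f : R →+* S} (hf : Function.Surjective f) :
    Function.Surjective (map f) := by
  rintro ⟨x, y, z⟩
  obtain ⟨x, rfl⟩ := hf x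
  obtain ⟨y, rfl⟩ := hf y
  obtain ⟨z, rfl⟩ := hf z
  exact ⟨⟨x, y, z⟩, rfl⟩

theorem eq_commutator_decomposition (g : Heis ℤ) :
    g = (α : Heis ℤ) ^ g.x * (β : Heis ℤ) ^ g.y * ⁅(α : Heis ℤ), (β : Heis ℤ)⁆ ^ (g.z - g.x * g.y) := by
  have h1 : (α : Heis ℤ) ^ g.x = ⟨g.x, 0, 0⟩ := by
    ext
    · simp [zpow_x]
    · simp [zpow_y]
    · rw [zpow_z_of_y_eq_zero rfl]; simp
  have h2 : (β : Heis ℤ) ^ g.y = ⟨0, g.y, 0⟩ := by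
    ext
    · simp [zpow_x]
    · simp [zpow_y]
    · rw [zpow_z_of_x_eq_zero rfl]; simp
  have h3 : ∀ n : ℤ, ⁅(α : Heis ℤ), (β : Heis ℤ)⁆ ^ n = ⟨0, 0, n⟩ := by
    intro n
    ext
    · simp [zpow_x, commutatorElement_eq]
    · simp [zpow_y, commutatorElement_eq]
    · rw [zpow_z_of_x_eq_zero (by simp [commutatorElement_eq])]; simp [commutatorElement_eq]
  rw [h1, h2, h3]
  ext <;> simp

theorem closure_α_β : Subgroup.closure {α, β} = (⊤ : Subgroup (Heis ℤ)) := by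
  rw [eq_top_iff]
  intro g _
  have hα : (α : Heis ℤ) ∈ Subgroup.closure {(α : Heis ℤ), β} :=
    Subgroup.subset_closure (by simp)
  have hβ : (β : Heis ℤ) ∈ Subgroup.closure {(α : Heis ℤ), β} :=
    Subgroup.subset_closure (by simp)
  rw [eq_commutator_decomposition g, commutatorElement_def]
  exact mul_mem (mul_mem (zpow_mem hα _) (zpow_mem hβ _))
    (zpow_mem (mul_mem (mul_mem (mul_mem hα hβ) (inv_mem hα)) (inv_mem hβ)) _)

/-- The coordinate model of the Heisenberg group is isomorphic to the group of matrices. -/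
def equivHeisenberg (R : Type*) [CommRing R] : Heis R ≃* heisenberg R where
  toFun g := ⟨⟨!![1, g.x, g.z; 0, 1, g.y; 0, 0, 1], by simp [Matrix.det_fin_three]⟩, by
    constructor
    · intro i
      fin_cases i <;> simp
    · intro i j h
      fin_cases i <;> fin_cases j <;> first
        | exact absurd h (by decide)
        | simp⟩
  invFun M := ⟨M.1 0 1, M.1 1 2, M.1 0 2⟩
  left_inv g := by ext <;> simp
  right_inv M := by
    obtain ⟨M, h1, h2⟩ := M
    have h10 := h2 1 0 (by decide)
    have h20 := h2 2 0 (by decide)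
    have h21 := h2 2 1 (by decide)
    ext i j
    fin_cases i <;> fin_cases j <;> simp [h1, h10, h20, h21]
  map_mul' g h := by
    apply Subtype.ext
    apply Subtype.ext
    change !![1, g.x + h.x, g.z + h.z + g.x * h.y; 0, 1, g.y + h.y; 0, 0, 1] =
      !![1, g.x, g.z; 0, 1, g.y; 0, 0, 1] * !![1, h.x, h.z; 0, 1, h.y; 0, 0, 1]
    ext i j
    fin_cases i <;> fin_cases j <;> simp [Matrix.mul_apply, Fin.sum_univ_three] <;> ring

end Heis

-- The Basilica group as a group of permutations of words

open Equiv (Perm)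

/-- The permutations of the words in an alphabet with `p` letters. -/
abbrev WordPerm (p : ℕ) : Type := Perm (List (Fin p))

/-- The permutation of the words underlying the automorphism `a`. -/
def permA (p : ℕ) : WordPerm p := (a p).toEquiv

/-- The permutation of the words underlying the automorphism `b`. -/
def permB (p : ℕ) : WordPerm p := (b p).toEquiv

/-- The `p`-Basilica group as a group of permutations of the words. -/
def permBasilica (p : ℕ) : Subgroup (WordPerm p) := Subgroup.closure {permA p, permB p}

/-- The permutations that fix all words of length at most `n`. -/
def wordStabilizer (p n : ℕ) : Subgroup (WordPerm p) where
  carrier := {f | ∀ u : List (Fin p), u.length ≤ n → f u = u}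
  one_mem' := fun _ _ => rfl
  mul_mem' := fun {f g} hf hg u hu => by
    change f (g u) = u
    rw [hg u hu, hf u hu]
  inv_mem' := fun {f} hf u hu => by
    rw [Equiv.Perm.inv_eq_iff_eq, hf u hu]

variable {p : ℕ}

theorem permA_mem : permA p ∈ permBasilica p := Subgroup.subset_closure (by simp)

theorem permB_mem : permB p ∈ permBasilica p := Subgroup.subset_closure (by simp)

theorem wordStabilizer_anti {m n : ℕ} (h : m ≤ n) : wordStabilizer p n ≤ wordStabilizer p m :=
  fun _ hf u hu => hf u (hu.trans h)

theorem permA_cons (x : Fin p) (v : List (Fin p)) :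
    permA p (x :: v) = x :: (if x.val + 1 = p then permB p v else v) := by
  change aFun (x :: v) = x :: (if x.val + 1 = p then bFun v else v)
  rw [aFun]

theorem permB_cons (x : Fin p) (v : List (Fin p)) :
    permB p (x :: v) = finRotate p x :: (if x.val + 1 = p then permA p v else v) := by
  change bFun (x :: v) = finRotate p x :: (if x.val + 1 = p then aFun v else v)
  rw [bFun]

theorem permA_inv_cons (x : Fin p) (v : List (Fin p)) :
    (permA p)⁻¹ (x :: v) = x :: (if x.val + 1 = p then (permB p)⁻¹ v else v) := by
  change aInv (x :: v) = x :: (if x.val + 1 = p then bInv v else v)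
  rw [aInv]

theorem permB_inv_cons (x : Fin p) (v : List (Fin p)) :
    (permB p)⁻¹ (x :: v) = (finRotate p).symm x ::
      (if ((finRotate p).symm x).val + 1 = p then (permA p)⁻¹ v else v) := by
  change bInv (x :: v) = (finRotate p).symm x ::
      (if ((finRotate p).symm x).val + 1 = p then aInv v else v)
  rw [bInv]

theorem finRotate_val (x : Fin p) :
    (finRotate p x).val = if x.val + 1 = p then 0 else x.val + 1 := by
  cases p with
  | zero => exact x.elim0
  | succ n =>
    rw [coe_finRotate]
    simp [Fin.ext_iff]

theorem permA_nil : permA p [] = [] := by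
  change aFun [] = []
  rw [aFun]

theorem permB_nil : permB p [] = [] := by
  change bFun [] = []
  rw [bFun]

theorem apply_nil {g : WordPerm p} (hg : g ∈ permBasilica p) : g [] = [] := by
  have : permBasilica p ≤ wordStabilizer p 0 := by
    rw [permBasilica, Subgroup.closure_le]
    rintro _ (rfl | rfl) u hu <;> obtain rfl := List.length_eq_zero_iff.1 (Nat.le_zero.1 hu)
    · exact permA_nil
    · exact permB_nil
  exact this hg [] le_rfl

-- The graph of χ and the recursion for its coordinates

/-- The graph of the homomorphism from the `p`-Basilica group to the integral Heisenberg group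
that maps `a` and `b` to the standard generators. -/
def heisGraph (p : ℕ) : Subgroup (WordPerm p × Heis ℤ) :=
  Subgroup.closure {(permA p, Heis.α), (permB p, Heis.β)}

theorem permA_mem_heisGraph : (permA p, Heis.α) ∈ heisGraph p :=
  Subgroup.subset_closure (by simp)

theorem permB_mem_heisGraph : (permB p, Heis.β) ∈ heisGraph p :=
  Subgroup.subset_closure (by simp)

theorem map_fst_heisGraph :
    (heisGraph p).map (MonoidHom.fst _ _) = permBasilica p := by
  rw [heisGraph, MonoidHom.map_closure, permBasilica, Set.image_pair]
  rfl

theorem fst_mem_of_mem_heisGraph {r : WordPerm p × Heis ℤ} (hr : r ∈ heisGraph p) :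
    r.1 ∈ permBasilica p := by
  rw [← map_fst_heisGraph]
  exact ⟨r, hr, rfl⟩

theorem exists_mem_heisGraph {g : WordPerm p} (hg : g ∈ permBasilica p) :
    ∃ h, (g, h) ∈ heisGraph p := by
  rw [← map_fst_heisGraph] at hg
  obtain ⟨⟨g, h⟩, hr, rfl⟩ := hg
  exact ⟨h, hr⟩

theorem sum_update {ι κ M : Type*} [Fintype ι] [DecidableEq ι] [AddCommGroup M] (F : ι → κ → M)
    (s : ι → κ) (i : ι) (t : κ) :
    ∑ j, F j (Function.update s i t j) = ∑ j, F j (s j) + (F i t - F i (s i)) := by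
  rw [← Finset.add_sum_erase _ _ (Finset.mem_univ i),
    ← Finset.add_sum_erase _ (fun j => F j (s j)) (Finset.mem_univ i),
    Finset.sum_congr rfl fun j hj => by rw [Function.update_of_ne (Finset.ne_of_mem_erase hj)]]
  simp only [Function.update_self]
  abel

/-- `s` is a family of sections of the pair `r` with first-level permutation `τ`: the sections
describe the action of `r.1` below the first level, and determine the coordinates of `r.2`. -/
structure IsSections (r : WordPerm p × Heis ℤ) (τ : Perm (Fin p))
    (s : Fin p → WordPerm p × Heis ℤ) : Prop where
  mem : ∀ x, s x ∈ heisGraph p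
  perm : ∀ x, ((τ x).val : ℤ) = (x.val + r.2.y) % p
  apply : ∀ x v, r.1 (x :: v) = τ x :: (s x).1 v
  sec_x : ∀ x, (s x).2.x = (x.val + r.2.y) / p
  x_eq : r.2.x = ∑ x, (s x).2.y
  z_eq : r.2.z = ∑ x, (p * ((s x).2.x * (s x).2.y - (s x).2.z) -
    ((x.val : ℤ) - (p - 1)) * (s x).2.y)

theorem emod_ediv_add_one {p : ℕ} (n : ℤ) (hp : 0 < p) :
    ((n + 1) % p = if n % p + 1 = p then 0 else n % p + 1) ∧
    ((n + 1) / p = if n % p + 1 = p then n / p + 1 else n / p) := by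
  have h0 : (0 : ℤ) < p := by exact_mod_cast hp
  have h1 := Int.emod_lt_of_pos n h0
  have h2 := Int.emod_nonneg n h0.ne'
  have h3 := Int.mul_ediv_add_emod n p
  split_ifs with h
  · have h4 : n + 1 = (n / p + 1) * p := by linarith
    rw [h4]
    exact ⟨Int.mul_emod_left _ _, Int.mul_ediv_cancel _ h0.ne'⟩
  · have h4 : n + 1 = (n % p + 1) + p * (n / p) := by linarith
    have h5 : n % p + 1 < p := by omega
    constructor
    · conv_lhs => rw [h4]
      rw [Int.add_mul_emod_self_left, Int.emod_eq_of_lt (by omega) h5]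
    · conv_lhs => rw [h4]
      rw [Int.add_mul_ediv_left _ _ h0.ne', Int.ediv_eq_zero_of_lt (by omega) h5, zero_add]

theorem emod_ediv_sub_one {p : ℕ} (n : ℤ) (hp : 0 < p) :
    ((n - 1) % p = if n % p = 0 then (p : ℤ) - 1 else n % p - 1) ∧
    ((n - 1) / p = if n % p = 0 then n / p - 1 else n / p) := by
  have h0 : (0 : ℤ) < p := by exact_mod_cast hp
  have h1 := Int.emod_lt_of_pos n h0
  have h2 := Int.emod_nonneg n h0.ne'
  obtain ⟨h3, h4⟩ := emod_ediv_add_one (n - 1) hp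
  have h5 := Int.emod_lt_of_pos (n - 1) h0
  have h6 := Int.emod_nonneg (n - 1) h0.ne'
  rw [sub_add_cancel] at h3 h4
  split_ifs at h3 h4 ⊢ <;> omega

theorem sections_one : IsSections (1 : WordPerm p × Heis ℤ) 1 1 where
  mem _ := one_mem _
  perm x := by
    simp only [Equiv.Perm.coe_one, id_eq, Prod.snd_one, Heis.one_y, add_zero]
    rw [Int.emod_eq_of_lt (by positivity) (by exact_mod_cast x.2)]
  apply x v := rfl
  sec_x x := by
    simp only [Pi.one_apply, Prod.snd_one, Heis.one_y, Heis.one_x, add_zero]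
    rw [Int.ediv_eq_zero_of_lt (by positivity) (by exact_mod_cast x.2)]
  x_eq := by simp
  z_eq := by simp

/-- The only nontrivial section of a is b at the last letter, so just the section at the letter i
with τ i last is changed, by a left factor b. -/
theorem IsSections.permA_mul {r : WordPerm p × Heis ℤ} {τ : Perm (Fin p)}
    {s : Fin p → WordPerm p × Heis ℤ} (h : IsSections r τ s) {i : Fin p}
    (hi : (τ i).val + 1 = p) :
    IsSections ((permA p, Heis.α) * r) τ (Function.update s i ((permB p, Heis.β) * s i)) where
  mem x := by
    rcases eq_or_ne x i with rfl | hx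
    · simpa using mul_mem permB_mem_heisGraph (h.mem x)
    · simpa [hx] using h.mem x
  perm x := by simpa using h.perm x
  apply x v := by
    simp only [Prod.fst_mul, Equiv.Perm.mul_apply, h.apply, permA_cons]
    rcases eq_or_ne x i with rfl | hx
    · simp [hi]
    · rw [if_neg fun hc => hx (τ.injective (Fin.ext (by omega))), Function.update_of_ne hx]
  sec_x x := by
    rcases eq_or_ne x i with rfl | hx
    · simpa using h.sec_x x
    · simpa [hx] using h.sec_x x
  x_eq := by
    rw [sum_update (fun (_ : Fin p) (t : WordPerm p × Heis ℤ) => t.2.y)]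
    simp [h.x_eq, add_comm]
  z_eq := by
    rw [sum_update (fun (x : Fin p) (t : WordPerm p × Heis ℤ) =>
      p * (t.2.x * t.2.y - t.2.z) - ((x.val : ℤ) - (p - 1)) * t.2.y), ← h.z_eq]
    -- The corner of α * r exceeds that of r by r.2.y, while the sum grows by p * (s i).2.x - (i -
    -- (p - 1)). These agree because τ i is the last letter, so i + r.2.y has remainder p - 1.
    have h1 := h.perm i
    have h2 := h.sec_x i
    have h3 := Int.mul_ediv_add_emod (i.val + r.2.y) p
    rw [← h1, ← h2] at h3
    have h4 : ((τ i).val : ℤ) + 1 = p := by exact_mod_cast hi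
    simp
    linear_combination -h3 + h4

theorem IsSections.permA_inv_mul {r : WordPerm p × Heis ℤ} {τ : Perm (Fin p)}
    {s : Fin p → WordPerm p × Heis ℤ} (h : IsSections r τ s) {i : Fin p}
    (hi : (τ i).val + 1 = p) :
    IsSections ((permA p, Heis.α)⁻¹ * r) τ
      (Function.update s i ((permB p, Heis.β)⁻¹ * s i)) where
  mem x := by
    rcases eq_or_ne x i with rfl | hx
    · simpa using mul_mem (inv_mem permB_mem_heisGraph) (h.mem x)
    · simpa [hx] using h.mem x
  perm x := by simpa using h.perm x
  apply x v := by
    simp only [Prod.fst_mul, Prod.fst_inv, Equiv.Perm.mul_apply, h.apply, permA_inv_cons]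
    rcases eq_or_ne x i with rfl | hx
    · simp [hi]
    · rw [if_neg fun hc => hx (τ.injective (Fin.ext (by omega))), Function.update_of_ne hx]
  sec_x x := by
    rcases eq_or_ne x i with rfl | hx
    · simpa using h.sec_x x
    · simpa [hx] using h.sec_x x
  x_eq := by
    rw [sum_update (fun (_ : Fin p) (t : WordPerm p × Heis ℤ) => t.2.y)]
    simp [h.x_eq, add_comm]
  z_eq := by
    rw [sum_update (fun (x : Fin p) (t : WordPerm p × Heis ℤ) =>
      p * (t.2.x * t.2.y - t.2.z) - ((x.val : ℤ) - (p - 1)) * t.2.y), ← h.z_eq]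
    have h1 := h.perm i
    have h2 := h.sec_x i
    have h3 := Int.mul_ediv_add_emod (i.val + r.2.y) p
    rw [← h1, ← h2] at h3
    have h4 : ((τ i).val : ℤ) + 1 = p := by exact_mod_cast hi
    simp
    linear_combination h3 - h4

/-- An odometer: b adds one to the first letter, and the carry contributes a factor a to the section
at the letter that wraps around. The corner is unchanged, in line with x * y - z being invariant
under left multiplication by α. -/
theorem IsSections.permB_mul {r : WordPerm p × Heis ℤ} {τ : Perm (Fin p)}
    {s : Fin p → WordPerm p × Heis ℤ} (h : IsSections r τ s) {i : Fin p}
    (hi : (τ i).val + 1 = p) :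
    IsSections ((permB p, Heis.β) * r) (finRotate p * τ)
      (Function.update s i ((permA p, Heis.α) * s i)) where
  mem x := by
    rcases eq_or_ne x i with rfl | hx
    · simpa using mul_mem permA_mem_heisGraph (h.mem x)
    · simpa [hx] using h.mem x
  perm x := by
    have h1 := (emod_ediv_add_one (x.val + r.2.y) i.pos).1
    rw [← h.perm] at h1
    rw [Equiv.Perm.mul_apply, finRotate_val]
    simp only [Prod.snd_mul, Heis.mul_y, Heis.β_y]
    rw [show (x.val + (1 + r.2.y) : ℤ) = x.val + r.2.y + 1 by ring, h1]
    split_ifs <;> omega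
  apply x v := by
    simp only [Prod.fst_mul, Equiv.Perm.mul_apply, h.apply, permB_cons]
    rcases eq_or_ne x i with rfl | hx
    · simp [hi]
    · rw [if_neg fun hc => hx (τ.injective (Fin.ext (by omega))), Function.update_of_ne hx]
  sec_x x := by
    have h1 := (emod_ediv_add_one (x.val + r.2.y) i.pos).2
    rw [← h.perm, ← h.sec_x] at h1
    simp only [Prod.snd_mul, Heis.mul_y, Heis.β_y]
    rw [show (x.val + (1 + r.2.y) : ℤ) = x.val + r.2.y + 1 by ring, h1]
    rcases eq_or_ne x i with rfl | hx
    · rw [if_pos (by exact_mod_cast hi)]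
      simp [add_comm]
    · rw [if_neg fun hc => hx (τ.injective (Fin.ext (by omega))), Function.update_of_ne hx]
  x_eq := by
    rw [sum_update (fun (_ : Fin p) (t : WordPerm p × Heis ℤ) => t.2.y)]
    simp [h.x_eq]
  z_eq := by
    rw [sum_update (fun (x : Fin p) (t : WordPerm p × Heis ℤ) =>
      p * (t.2.x * t.2.y - t.2.z) - ((x.val : ℤ) - (p - 1)) * t.2.y), ← h.z_eq]
    simp
    ring

/-- Subtracting one borrows at the first letter, so the affected section is the one with τ i = 0. -/
theorem IsSections.permB_inv_mul {r : WordPerm p × Heis ℤ} {τ : Perm (Fin p)}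
    {s : Fin p → WordPerm p × Heis ℤ} (h : IsSections r τ s) {i : Fin p}
    (hi : (τ i).val = 0) :
    IsSections ((permB p, Heis.β)⁻¹ * r) ((finRotate p)⁻¹ * τ)
      (Function.update s i ((permA p, Heis.α)⁻¹ * s i)) := by
  have key : ∀ y : Fin p, ((finRotate p)⁻¹ y).val = if y.val = 0 then p - 1 else y.val - 1 := by
    intro y
    rw [Equiv.Perm.inv_def]
    have h1 := finRotate_val ((finRotate p).symm y)
    rw [Equiv.apply_symm_apply] at h1
    split_ifs at h1 ⊢ <;> omega
  have hpos := i.pos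
  refine ⟨fun x => ?_, fun x => ?_, fun x v => ?_, fun x => ?_, ?_, ?_⟩
  · rcases eq_or_ne x i with rfl | hx
    · simpa using mul_mem (inv_mem permA_mem_heisGraph) (h.mem x)
    · simpa [hx] using h.mem x
  · have h1 := (emod_ediv_sub_one (x.val + r.2.y) i.pos).1
    rw [← h.perm] at h1
    rw [Equiv.Perm.mul_apply, key]
    simp only [Prod.snd_mul, Prod.snd_inv, Heis.mul_y, Heis.inv_y, Heis.β_y]
    rw [show (x.val + (-1 + r.2.y) : ℤ) = x.val + r.2.y - 1 by ring, h1]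
    split_ifs <;> omega
  · simp only [Prod.fst_mul, Prod.fst_inv, Equiv.Perm.mul_apply, h.apply, permB_inv_cons]
    have h2 := key (τ x)
    change ((finRotate p).symm (τ x)).val = _ at h2
    rw [Equiv.Perm.inv_def (finRotate p)]
    rcases eq_or_ne x i with rfl | hx
    · rw [if_pos hi] at h2
      rw [if_pos (by omega)]
      simp
    · have h3 : (τ x).val ≠ 0 := fun hc => hx (τ.injective (Fin.ext (by omega)))
      rw [if_neg h3] at h2
      rw [if_neg (by omega), Function.update_of_ne hx]
  · have h1 := (emod_ediv_sub_one (x.val + r.2.y) i.pos).2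
    rw [← h.perm, ← h.sec_x] at h1
    simp only [Prod.snd_mul, Prod.snd_inv, Heis.mul_y, Heis.inv_y, Heis.β_y]
    rw [show (x.val + (-1 + r.2.y) : ℤ) = x.val + r.2.y - 1 by ring, h1]
    rcases eq_or_ne x i with rfl | hx
    · rw [if_pos (by exact_mod_cast hi)]
      simp
      ring
    · rw [if_neg fun hc => hx (τ.injective (Fin.ext (by omega))), Function.update_of_ne hx]
  · rw [sum_update (fun (_ : Fin p) (t : WordPerm p × Heis ℤ) => t.2.y)]
    simp [h.x_eq]
  · rw [sum_update (fun (x : Fin p) (t : WordPerm p × Heis ℤ) =>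
      p * (t.2.x * t.2.y - t.2.z) - ((x.val : ℤ) - (p - 1)) * t.2.y), ← h.z_eq]
    simp
    ring

theorem exists_isSections (hp : 0 < p) {r : WordPerm p × Heis ℤ} (hr : r ∈ heisGraph p) :
    ∃ τ s, IsSections r τ s := by
  have last : ∀ τ : Perm (Fin p), ∃ i, (τ i).val + 1 = p := fun τ =>
    ⟨τ⁻¹ ⟨p - 1, by omega⟩, by simp; omega⟩
  have first : ∀ τ : Perm (Fin p), ∃ i, (τ i).val = 0 := fun τ => ⟨τ⁻¹ ⟨0, hp⟩, by simp⟩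
  induction hr using Subgroup.closure_induction_left with
  | one => exact ⟨1, 1, sections_one⟩
  | mul_left x hx y hy ih =>
    obtain ⟨τ, s, h⟩ := ih
    obtain ⟨i, hi⟩ := last τ
    rcases hx with rfl | rfl
    · exact ⟨_, _, h.permA_mul hi⟩
    · exact ⟨_, _, h.permB_mul hi⟩
  | inv_mul_cancel x hx y hy ih =>
    obtain ⟨τ, s, h⟩ := ih
    rcases hx with rfl | rfl
    · obtain ⟨i, hi⟩ := last τ
      exact ⟨_, _, h.permA_inv_mul hi⟩
    · obtain ⟨i, hi⟩ := first τ
      exact ⟨_, _, h.permB_inv_mul hi⟩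

theorem IsSections.apply_eq_of_mem_wordStabilizer {r : WordPerm p × Heis ℤ} {τ : Perm (Fin p)}
    {s : Fin p → WordPerm p × Heis ℤ} (h : IsSections r τ s) {n : ℕ}
    (hr : r.1 ∈ wordStabilizer p (n + 1)) (x : Fin p) :
    τ x = x ∧ (s x).1 ∈ wordStabilizer p n := by
  have key : ∀ v : List (Fin p), v.length ≤ n → τ x = x ∧ (s x).1 v = v := by
    intro v hv
    have h1 := hr (x :: v) (by simpa using hv)
    rw [h.apply] at h1
    simpa using h1
  exact ⟨(key [] (Nat.zero_le _)).1, fun v hv => (key v hv).2⟩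

theorem IsSections.y_eq {r : WordPerm p × Heis ℤ} {τ : Perm (Fin p)}
    {s : Fin p → WordPerm p × Heis ℤ} (h : IsSections r τ s) {x : Fin p} (hx : τ x = x) :
    r.2.y = p * (s x).2.x := by
  have h1 := h.perm x
  have h2 := h.sec_x x
  have h3 := Int.mul_ediv_add_emod (x.val + r.2.y) p
  rw [← h2, ← h1, hx] at h3
  linarith

-- Divisibility on level stabilisers and existence of χ

/-- One level down, y is p times an x-coordinate, and x is a sum of y-coordinates. Two levels thus
gain a factor p in both. -/
theorem pow_dvd_xy_of_mem_wordStabilizer (hp : 0 < p) (n : ℕ) :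
    ∀ r ∈ heisGraph p, r.1 ∈ wordStabilizer p (2 * n) →
      (p : ℤ) ^ n ∣ r.2.x ∧ (p : ℤ) ^ n ∣ r.2.y := by
  induction n with
  | zero => simp
  | succ n ih =>
    have step : ∀ r ∈ heisGraph p, r.1 ∈ wordStabilizer p (2 * n + 1) →
        (p : ℤ) ^ n ∣ r.2.x ∧ (p : ℤ) ^ (n + 1) ∣ r.2.y := by
      intro r hr hst
      obtain ⟨τ, s, h⟩ := exists_isSections hp hr
      have h1 := h.apply_eq_of_mem_wordStabilizer hst
      refine ⟨?_, ?_⟩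
      · rw [h.x_eq]
        exact Finset.dvd_sum fun x _ => (ih _ (h.mem x) (h1 x).2).2
      · rw [h.y_eq (h1 ⟨0, hp⟩).1, pow_succ']
        exact mul_dvd_mul_left _ (ih _ (h.mem _) (h1 _).2).1
    intro r hr hst
    obtain ⟨τ, s, h⟩ := exists_isSections hp hr
    have h1 := h.apply_eq_of_mem_wordStabilizer (n := 2 * n + 1) hst
    refine ⟨?_, (step r hr (wordStabilizer_anti (by omega) hst)).2⟩
    rw [h.x_eq]
    exact Finset.dvd_sum fun x _ => (step _ (h.mem x) (h1 x).2).2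

/-- In the formula for z only the term in y lacks a factor p, so p ^ (n + 1) must divide the
y-coordinates of the sections. They fix level 3n + 2, which is at least 2(n + 1). -/
theorem pow_dvd_of_mem_wordStabilizer (hp : 0 < p) (n : ℕ) :
    ∀ r ∈ heisGraph p, r.1 ∈ wordStabilizer p (3 * n) →
      (p : ℤ) ^ n ∣ r.2.x ∧ (p : ℤ) ^ n ∣ r.2.y ∧ (p : ℤ) ^ n ∣ r.2.z := by
  intro r hr hst
  refine ⟨(pow_dvd_xy_of_mem_wordStabilizer hp n r hr (wordStabilizer_anti (by omega) hst)).1,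
    (pow_dvd_xy_of_mem_wordStabilizer hp n r hr (wordStabilizer_anti (by omega) hst)).2, ?_⟩
  induction n generalizing r with
  | zero => simp
  | succ n ih =>
    obtain ⟨τ, s, h⟩ := exists_isSections hp hr
    have h1 := h.apply_eq_of_mem_wordStabilizer (n := 3 * n + 2) hst
    rw [h.z_eq]
    refine Finset.dvd_sum fun x _ => dvd_sub ?_ ?_
    · rw [pow_succ']
      refine mul_dvd_mul_left _ (dvd_sub ?_ ?_)
      · exact Dvd.dvd.mul_left (pow_dvd_xy_of_mem_wordStabilizer hp n _ (h.mem x)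
          (wordStabilizer_anti (by omega) (h1 x).2)).2 _
      · exact ih _ (h.mem x) (wordStabilizer_anti (by omega) (h1 x).2)
    · by_cases hn : n = 0
      · subst hn
        exact Dvd.dvd.mul_left (pow_dvd_xy_of_mem_wordStabilizer hp 1 _ (h.mem x)
          (wordStabilizer_anti (by omega) (h1 x).2)).2 _
      · exact Dvd.dvd.mul_left (pow_dvd_xy_of_mem_wordStabilizer hp (n + 1) _ (h.mem x)
          (wordStabilizer_anti (by omega) (h1 x).2)).2 _

theorem eq_zero_of_forall_pow_dvd (hp : 1 < p) {z : ℤ} (h : ∀ n : ℕ, (p : ℤ) ^ n ∣ z) :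
    z = 0 := by
  refine Int.eq_zero_of_abs_lt_dvd (h z.natAbs) ?_
  rw [Int.abs_eq_natAbs]
  exact_mod_cast Nat.lt_pow_self hp

theorem snd_eq_one_of_fst_eq_one (hp : 1 < p) {r : WordPerm p × Heis ℤ} (hr : r ∈ heisGraph p)
    (h : r.1 = 1) : r.2 = 1 := by
  have key := fun n => pow_dvd_of_mem_wordStabilizer (zero_lt_one.trans hp) n r hr
    (by rw [h]; exact one_mem _)
  ext
  · exact eq_zero_of_forall_pow_dvd hp fun n => (key n).1
  · exact eq_zero_of_forall_pow_dvd hp fun n => (key n).2.1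
  · exact eq_zero_of_forall_pow_dvd hp fun n => (key n).2.2

theorem heisGraph_unique (hp : 1 < p) {g : WordPerm p} {h h' : Heis ℤ}
    (hh : (g, h) ∈ heisGraph p) (hh' : (g, h') ∈ heisGraph p) : h = h' := by
  have := snd_eq_one_of_fst_eq_one hp (mul_mem hh (inv_mem hh')) (by simp)
  simpa [mul_inv_eq_one] using this

/-- A tree automorphism as a permutation of the words. -/
def toWordPerm (p : ℕ) : TreeAut p →* WordPerm p where
  toFun := RelIso.toEquiv
  map_one' := rfl
  map_mul' _ _ := rfl

theorem toWordPerm_injective : Function.Injective (toWordPerm p) := RelIso.toEquiv_injective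

theorem map_basilica : (basilica p).map (toWordPerm p) = permBasilica p := by
  rw [basilica, MonoidHom.map_closure, permBasilica, Set.image_pair]
  rfl

theorem toWordPerm_mem {g : TreeAut p} (hg : g ∈ basilica p) :
    toWordPerm p g ∈ permBasilica p := by
  rw [← map_basilica]
  exact ⟨g, hg, rfl⟩

theorem exists_heisHom (hp : 1 < p) :
    ∃ χ : basilica p →* Heis ℤ, ∀ g, (toWordPerm p g.1, χ g) ∈ heisGraph p := by
  choose χ hχ using fun g : basilica p => exists_mem_heisGraph (toWordPerm_mem g.2)
  refine ⟨⟨⟨χ, ?_⟩, ?_⟩, hχ⟩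
  · exact heisGraph_unique hp (hχ 1) (one_mem _)
  · intro g h
    exact heisGraph_unique hp (hχ (g * h)) (mul_mem (hχ g) (hχ h))

-- Powers of the generators and the Heisenberg quotients

theorem permB_cons_iterate (hp : 0 < p) {k : ℕ} (hk : k < p) (v : List (Fin p)) :
    (permB p ^ k) (⟨0, hp⟩ :: v) = ⟨k, hk⟩ :: v := by
  induction k with
  | zero => rfl
  | succ k ih =>
    rw [pow_succ', Equiv.Perm.mul_apply, ih (by omega), permB_cons, if_neg (by simp; omega)]
    congr 1
    ext
    rw [finRotate_val, if_neg (by simp; omega)]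

/-- b^p = (a, …, a): p rotations bring each letter back after passing the last letter exactly once.
-/
theorem permB_pow_cons (x : Fin p) (v : List (Fin p)) :
    (permB p ^ p) (x :: v) = x :: permA p v := by
  have hp := x.pos
  have h1 : ∀ w : List (Fin p), (permB p ^ (x : ℕ)) (⟨0, hp⟩ :: w) = x :: w := fun w =>
    permB_cons_iterate hp x.2 w
  have h2 : (permB p ^ p) (⟨0, hp⟩ :: v) = ⟨0, hp⟩ :: permA p v := by
    have h3 : permB p ^ p = permB p * permB p ^ (p - 1) := by
      rw [← pow_succ', Nat.sub_add_cancel hp]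
    rw [h3, Equiv.Perm.mul_apply, permB_cons_iterate hp (Nat.sub_lt hp one_pos), permB_cons,
      if_pos (by simp; omega)]
    congr 1
    ext
    rw [finRotate_val, if_pos (by simp; omega)]
  rw [← h1 v, ← Equiv.Perm.mul_apply, ← pow_add, add_comm, pow_add, Equiv.Perm.mul_apply, h2, h1]

theorem pow_cons {f g : WordPerm p} {x : Fin p} (h : ∀ v, f (x :: v) = x :: g v) (k : ℕ)
    (v : List (Fin p)) : (f ^ k) (x :: v) = x :: (g ^ k) v := by
  induction k generalizing v with
  | zero => rfl
  | succ k ih => rw [pow_succ, Equiv.Perm.mul_apply, h, ih, pow_succ, Equiv.Perm.mul_apply]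

theorem pow_mem_wordStabilizer (n : ℕ) :
    permA p ^ p ^ n ∈ wordStabilizer p n ∧ permB p ^ p ^ n ∈ wordStabilizer p n := by
  have hnil : ∀ k : ℕ, (permA p ^ k) [] = [] ∧ (permB p ^ k) [] = [] := fun k =>
    ⟨apply_nil (pow_mem permA_mem k), apply_nil (pow_mem permB_mem k)⟩
  induction n with
  | zero =>
    constructor <;> intro u hu <;>
      obtain rfl := List.length_eq_zero_iff.1 (Nat.le_zero.1 hu)
    · exact (hnil _).1
    · exact (hnil _).2
  | succ n ih =>
    constructor <;> intro u hu
    · cases u with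
      | nil => exact (hnil _).1
      | cons x v =>
        have hv : v.length ≤ n := by simpa using hu
        by_cases hx : x.val + 1 = p
        · rw [pow_cons (g := permB p) (fun v => by rw [permA_cons, if_pos hx]), pow_succ, pow_mul,
            pow_mem ih.2 p v hv]
        · rw [pow_cons (g := 1) (fun v => by rw [permA_cons, if_neg hx]; rfl), one_pow]
          rfl
    · cases u with
      | nil => exact (hnil _).2
      | cons x v =>
        have hv : v.length ≤ n := by simpa using hu
        rw [pow_succ', pow_mul, pow_cons (permB_pow_cons x), ih.1 v hv]

/-- The generator `a` as an element of the `p`-Basilica group. -/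
def genA (p : ℕ) : basilica p := ⟨a p, Subgroup.subset_closure (by simp)⟩

/-- The generator `b` as an element of the `p`-Basilica group. -/
def genB (p : ℕ) : basilica p := ⟨b p, Subgroup.subset_closure (by simp)⟩

theorem genA_pow_mem (n : ℕ) : genA p ^ p ^ n ∈ levelStabilizerIn (basilica p) n := by
  intro u hu
  have h := (pow_mem_wordStabilizer (p := p) n).1 u hu.le
  change (toWordPerm p (a p) ^ p ^ n) u = u at h
  rwa [← map_pow] at h

theorem genB_pow_mem (n : ℕ) : genB p ^ p ^ n ∈ levelStabilizerIn (basilica p) n := by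
  intro u hu
  have h := (pow_mem_wordStabilizer (p := p) n).2 u hu.le
  change (toWordPerm p (b p) ^ p ^ n) u = u at h
  rwa [← map_pow] at h

theorem exists_heisenberg_quotient (hp : p.Prime) {q : ℕ} (hq : q.Prime) (hqp : q ≠ p) :
    ∃ (N : Subgroup (basilica p)) (_ : N.Normal),
      Nonempty ((basilica p ⧸ N) ≃* heisenberg (ZMod q)) ∧
      ∀ n : ℕ, ¬ ⁅levelStabilizerIn (basilica p) n, levelStabilizerIn (basilica p) n⁆ ≤ N := by
  obtain ⟨χ, hχ⟩ := exists_heisHom hp.one_lt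
  have hA : χ (genA p) = Heis.α := heisGraph_unique hp.one_lt (hχ _) permA_mem_heisGraph
  have hB : χ (genB p) = Heis.β := heisGraph_unique hp.one_lt (hχ _) permB_mem_heisGraph
  have hsurj : Function.Surjective χ := by
    rw [← MonoidHom.range_eq_top, eq_top_iff, ← Heis.closure_α_β, Subgroup.closure_le]
    rintro _ (rfl | rfl)
    · exact ⟨_, hA⟩
    · exact ⟨_, hB⟩
  let ψ : basilica p →* Heis (ZMod q) := (Heis.map (Int.castRingHom (ZMod q))).comp χ
  have hψ : Function.Surjective ψ :=
    (Heis.map_surjective (ZMod.ringHom_surjective _)).comp hsurj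
  refine ⟨ψ.ker, inferInstance, ⟨(QuotientGroup.quotientKerEquivOfSurjective ψ hψ).trans
    (Heis.equivHeisenberg (ZMod q))⟩, fun n hn => ?_⟩
  have h1 := hn (Subgroup.commutator_mem_commutator (genA_pow_mem n) (genB_pow_mem n))
  rw [MonoidHom.mem_ker, map_commutatorElement, map_pow, map_pow, Heis.commutatorElement_eq] at h1
  have h2 : ψ (genA p) = Heis.α := by
    change Heis.map _ (χ (genA p)) = _
    rw [hA]
    ext <;> simp [Heis.map]
  have h3 : ψ (genB p) = Heis.β := by
    change Heis.map _ (χ (genB p)) = _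
    rw [hB]
    ext <;> simp [Heis.map]
  -- The corner of [α^(p^n), β^(p^n)] is p^(2n); its vanishing mod q would give q = p.
  have h4 := congrArg Heis.z h1
  have := Fact.mk hq
  rw [h2, h3, Heis.pow_x, Heis.pow_y, Heis.pow_x, Heis.pow_y] at h4
  have h5 : ((p : ℕ) : ZMod q) = 0 := by
    by_contra h0
    simp [h0] at h4
  rw [ZMod.natCast_eq_zero_iff] at h5
  exact hqp ((Nat.prime_dvd_prime_iff_eq hq hp).1 h5)

theorem not_hasWeakCongruenceSubgroupProperty (hp : p.Prime) :
    ¬ HasWeakCongruenceSubgroupProperty (basilica p) := by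
  intro hw
  obtain ⟨q, hpq, hq⟩ := Nat.exists_infinite_primes (p + 1)
  obtain ⟨N, hN, ⟨e⟩, hn⟩ := exists_heisenberg_quotient hp hq (by omega)
  have := Fact.mk hq
  have : Finite (basilica p ⧸ N) := Finite.of_equiv _ e.toEquiv.symm
  obtain ⟨n, h⟩ := hw N Subgroup.finiteIndex_of_finite_quotient
  exact hn n h

theorem not_hasCongruenceSubgroupProperty (hp : p.Prime) :
    ¬ HasCongruenceSubgroupProperty (basilica p) := by
  intro hc
  refine not_hasWeakCongruenceSubgroupProperty hp fun H hH => ?_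
  obtain ⟨n, hn⟩ := hc H hH
  refine ⟨n, le_trans ?_ hn⟩
  rw [Subgroup.commutator_le]
  intro g hg h hh
  rw [commutatorElement_def]
  exact mul_mem (mul_mem (mul_mem hg hh) (inv_mem hg)) (inv_mem hh)

-- Commutator calculus

section Commutators

variable {Γ : Type*} [Group Γ]

theorem conj_mem_commutator {H K : Subgroup Γ} {g : Γ} (hH : ∀ h ∈ H, g * h * g⁻¹ ∈ H)
    (hK : ∀ h ∈ K, g * h * g⁻¹ ∈ K) {c : Γ} (hc : c ∈ ⁅H, K⁆) : g * c * g⁻¹ ∈ ⁅H, K⁆ := by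
  have key : ⁅H, K⁆ ≤ ⁅H, K⁆.comap (MulAut.conj g).toMonoidHom := by
    rw [Subgroup.commutator_le]
    intro h hh k hk
    rw [Subgroup.mem_comap, map_commutatorElement]
    exact Subgroup.commutator_mem_commutator (hH h hh) (hK k hk)
  exact key hc

theorem commutatorElement_mem_of_closure {S : Set Γ} {M : Subgroup Γ}
    (hM : ∀ g ∈ Subgroup.closure S, ∀ m ∈ M, g * m * g⁻¹ ∈ M) {y : Γ} (h : ∀ x ∈ S, ⁅x, y⁆ ∈ M)
    {g : Γ} (hg : g ∈ Subgroup.closure S) : ⁅g, y⁆ ∈ M := by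
  induction hg using Subgroup.closure_induction with
  | mem x hx => exact h x hx
  | one => rw [commutatorElement_one_left]; exact one_mem _
  | mul g g' hg hg' ih ih' =>
    have : ⁅g * g', y⁆ = g * ⁅g', y⁆ * g⁻¹ * ⁅g, y⁆ := by
      simp only [commutatorElement_def]; group
    rw [this]
    exact mul_mem (hM g hg _ ih') ih
  | inv g hg ih =>
    have : ⁅g⁻¹, y⁆ = g⁻¹ * ⁅g, y⁆⁻¹ * g⁻¹⁻¹ := by
      simp only [commutatorElement_def]; group
    rw [this]
    exact hM _ (inv_mem hg) _ (inv_mem ih)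

theorem commutator_closure_le {S : Set Γ} {M : Subgroup Γ}
    (hM : ∀ g ∈ Subgroup.closure S, ∀ m ∈ M, g * m * g⁻¹ ∈ M) (h : ∀ x ∈ S, ∀ y ∈ S, ⁅x, y⁆ ∈ M) :
    ⁅Subgroup.closure S, Subgroup.closure S⁆ ≤ M := by
  rw [Subgroup.commutator_le]
  intro g hg g' hg'
  refine commutatorElement_mem_of_closure hM (fun x hx => ?_) hg
  rw [← commutatorElement_inv]
  exact inv_mem (commutatorElement_mem_of_closure hM (fun y hy => h y hy x hx) hg')

/-- If the commutator of two generators is central modulo a normal subgroup, then it generates the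
derived subgroup modulo that subgroup. -/
theorem exists_zpow_mul_of_mem_commutator {x y : Γ} {M : Subgroup Γ}
    (hM : ∀ g ∈ Subgroup.closure {x, y}, ∀ m ∈ M, g * m * g⁻¹ ∈ M)
    (hx : ⁅x, ⁅x, y⁆⁆ ∈ M) (hy : ⁅y, ⁅x, y⁆⁆ ∈ M) {g : Γ}
    (hg : g ∈ ⁅Subgroup.closure {x, y}, Subgroup.closure {x, y}⁆) :
    ∃ n : ℤ, ∃ m ∈ M, g = ⁅x, y⁆ ^ n * m := by
  have hxG : x ∈ Subgroup.closure {x, y} := Subgroup.subset_closure (by simp)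
  have hyG : y ∈ Subgroup.closure {x, y} := Subgroup.subset_closure (by simp)
  have hzG : ⁅x, y⁆ ∈ Subgroup.closure {x, y} :=
    mul_mem (mul_mem (mul_mem hxG hyG) (inv_mem hxG)) (inv_mem hyG)
  have hz : ∀ g ∈ Subgroup.closure {x, y}, ⁅g, ⁅x, y⁆⁆ ∈ M := by
    intro g hg
    refine commutatorElement_mem_of_closure hM ?_ hg
    rintro _ (rfl | rfl)
    · exact hx
    · exact hy
  have hzM : ⁅x, y⁆ ∈ Subgroup.zpowers ⁅x, y⁆ ⊔ M :=
    Subgroup.mem_sup_left (Subgroup.mem_zpowers _)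
  have hle : ⁅Subgroup.closure {x, y}, Subgroup.closure {x, y}⁆ ≤
      Subgroup.zpowers ⁅x, y⁆ ⊔ M := by
    refine commutator_closure_le (fun g hg => ?_) ?_
    · have : Subgroup.zpowers ⁅x, y⁆ ⊔ M ≤
          (Subgroup.zpowers ⁅x, y⁆ ⊔ M).comap (MulAut.conj g).toMonoidHom := by
        refine sup_le ?_ ?_
        swap
        · intro m hm
          exact Subgroup.mem_sup_right (hM g hg m hm)
        rw [Subgroup.zpowers_le]
        change g * ⁅x, y⁆ * g⁻¹ ∈ Subgroup.zpowers ⁅x, y⁆ ⊔ M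
        rw [← inv_mul_cancel_right (g * ⁅x, y⁆ * g⁻¹) ⁅x, y⁆]
        exact mul_mem (Subgroup.mem_sup_right (hz g hg)) hzM
      exact this
    · rintro u (hu | hu) v (hv | hv) <;> rw [hu, hv]
      · rw [commutatorElement_self]; exact one_mem _
      · exact hzM
      · rw [← commutatorElement_inv x y]; exact inv_mem hzM
      · rw [commutatorElement_self]; exact one_mem _
  have hnorm : Subgroup.zpowers ⁅x, y⁆ ≤ Subgroup.normalizer (M : Set Γ) := by
    rw [Subgroup.zpowers_le, Subgroup.mem_normalizer_iff]
    intro m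
    refine ⟨hM _ hzG m, fun h => ?_⟩
    have := hM _ (inv_mem hzG) _ h
    rwa [inv_inv, show ∀ z : Γ, z⁻¹ * (z * m * z⁻¹) * z = m from fun z => by group] at this
  have h1 := hle hg
  rw [← SetLike.mem_coe, Subgroup.coe_mul_of_left_le_normalizer_right _ _ hnorm] at h1
  obtain ⟨_, ⟨n, rfl⟩, m, hm, rfl⟩ := h1
  exact ⟨n, m, hm, rfl⟩

end Commutators

-- Actions below a letter and self-replication

/-- The action on words with prescribed sections and trivial action on the first letter. -/
def diagFun (t : Fin p → WordPerm p) : List (Fin p) → List (Fin p)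
  | [] => []
  | x :: v => x :: t x v

/-- The embedding of `p` copies of the group of permutations of the words that lets the copy with
index `x` act on the words below the letter `x`. -/
def diag (p : ℕ) : (Fin p → WordPerm p) →* WordPerm p where
  toFun t := ⟨diagFun t, diagFun t⁻¹, fun w => by cases w <;> simp [diagFun],
    fun w => by cases w <;> simp [diagFun]⟩
  map_one' := by ext1 w; cases w <;> rfl
  map_mul' s t := by ext1 w; cases w <;> rfl

@[simp] theorem diag_nil (t : Fin p → WordPerm p) : diag p t [] = [] := rfl

@[simp] theorem diag_cons (t : Fin p → WordPerm p) (x : Fin p) (v : List (Fin p)) :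
    diag p t (x :: v) = x :: t x v := rfl

/-- The action on the words below the letter `x`. -/
def atLetter (x : Fin p) : WordPerm p →* WordPerm p :=
  (diag p).comp (MonoidHom.mulSingle (fun _ => WordPerm p) x)

theorem atLetter_apply (x : Fin p) (t : WordPerm p) :
    atLetter x t = diag p (Pi.mulSingle x t) := rfl

@[simp] theorem atLetter_nil (x : Fin p) (t : WordPerm p) : atLetter x t [] = [] := rfl

@[simp] theorem atLetter_cons_self (x : Fin p) (t : WordPerm p) (v : List (Fin p)) :
    atLetter x t (x :: v) = x :: t v := by
  rw [atLetter_apply, diag_cons, Pi.mulSingle_eq_same]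

theorem atLetter_cons_of_ne {x y : Fin p} (h : y ≠ x) (t : WordPerm p) (v : List (Fin p)) :
    atLetter x t (y :: v) = y :: v := by
  rw [atLetter_apply, diag_cons, Pi.mulSingle_eq_of_ne h, Equiv.Perm.one_apply]

theorem commute_atLetter {x y : Fin p} (h : x ≠ y) (s t : WordPerm p) :
    Commute (atLetter x s) (atLetter y t) := by
  rw [atLetter_apply, atLetter_apply]
  exact (Pi.mulSingle_commute (f := fun _ => WordPerm p) h s t).map (diag p)

theorem diag_mem {N : Subgroup (WordPerm p)} {t : Fin p → WordPerm p}
    (h : ∀ x, atLetter x (t x) ∈ N) : diag p t ∈ N :=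
  Subgroup.pi_mem_of_mulSingle_mem (H := N.comap (diag p)) t h

theorem exists_sections {g : WordPerm p} (hp : 0 < p) (hg : g ∈ permBasilica p) :
    ∃ (τ : Perm (Fin p)) (s : Fin p → WordPerm p), (∀ x, s x ∈ permBasilica p) ∧
      ∀ x v, g (x :: v) = τ x :: s x v := by
  obtain ⟨h, hr⟩ := exists_mem_heisGraph hg
  obtain ⟨τ, s, hs⟩ := exists_isSections hp hr
  exact ⟨τ, fun x => (s x).1, fun x => fst_mem_of_mem_heisGraph (hs.mem x), hs.apply⟩

theorem isSections_diag (hp : 0 < p) {t : Fin p → WordPerm p} {h : Heis ℤ}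
    (hr : (diag p t, h) ∈ heisGraph p) :
    ∃ k : Fin p → Heis ℤ, (∀ x, (t x, k x) ∈ heisGraph p) ∧
      IsSections (diag p t, h) 1 (fun x => (t x, k x)) := by
  obtain ⟨τ, s, hs⟩ := exists_isSections hp hr
  have key : ∀ x v, τ x = x ∧ (s x).1 v = t x v := by
    intro x v
    have := hs.apply x v
    rw [diag_cons] at this
    simpa [eq_comm] using this
  have hτ : τ = 1 := Equiv.ext fun x => (key x []).1
  have hs' : (fun x => (t x, (s x).2)) = s := by
    funext x
    exact Prod.ext (Equiv.ext fun v => (key x v).2.symm) rfl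
  subst hτ
  refine ⟨fun x => (s x).2, fun x => ?_, ?_⟩
  · have := hs.mem x
    rwa [← hs'] at this
  · rwa [hs']

theorem conj_atLetter (hp : 0 < p) {h s : WordPerm p} (hh : h ∈ permBasilica p) {x x' : Fin p}
    (hs : ∀ v, h (x :: v) = x' :: s v) (t : WordPerm p) :
    h * atLetter x t * h⁻¹ = atLetter x' (s * t * s⁻¹) := by
  rw [mul_inv_eq_iff_eq_mul]
  obtain ⟨τ, σ, -, hσ⟩ := exists_sections hp hh
  ext1 w
  rw [Equiv.Perm.mul_apply, Equiv.Perm.mul_apply]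
  cases w with
  | nil => rw [atLetter_nil, apply_nil hh, atLetter_nil]
  | cons y v =>
    rcases eq_or_ne y x with rfl | hy
    · rw [atLetter_cons_self, hs, hs, atLetter_cons_self]
      simp
    · have hx : τ x = x' := by
        have := hs []
        rw [hσ] at this
        exact (List.cons.inj this).1
      rw [atLetter_cons_of_ne hy, hσ, atLetter_cons_of_ne]
      exact fun hc => hy (τ.injective (hc.trans hx.symm))

/-- G is self-replicating and transitive on letters. At the letter 0, b^p has section a, and
conjugating a by b^(p-1) carries its section b there from the last letter; powers of b then change
the letters. -/
theorem exists_lift {g : WordPerm p} (hg : g ∈ permBasilica p) (x x' : Fin p) :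
    ∃ h ∈ permBasilica p, ∀ v, h (x :: v) = x' :: g v := by
  have hp := x.pos
  have base : ∃ h ∈ permBasilica p, ∀ v, h (⟨0, hp⟩ :: v) = ⟨0, hp⟩ :: g v := by
    induction hg using Subgroup.closure_induction with
    | mem g hg =>
      rcases hg with rfl | rfl
      · exact ⟨_, pow_mem permB_mem p, permB_pow_cons _⟩
      · refine ⟨(permB p ^ (p - 1))⁻¹ * permA p * permB p ^ (p - 1),
          mul_mem (mul_mem (inv_mem (pow_mem permB_mem _)) permA_mem) (pow_mem permB_mem _),
          fun v => ?_⟩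
        have h1 := permB_cons_iterate hp (Nat.sub_lt hp one_pos)
        rw [Equiv.Perm.mul_apply, Equiv.Perm.mul_apply, Equiv.Perm.inv_eq_iff_eq, h1, h1,
          permA_cons, if_pos (by simp; omega)]
    | one => exact ⟨1, one_mem _, fun v => rfl⟩
    | mul g g' _ _ ih ih' =>
      obtain ⟨h, hh, h1⟩ := ih
      obtain ⟨h', hh', h1'⟩ := ih'
      exact ⟨h * h', mul_mem hh hh', fun v => by simp [h1, h1']⟩
    | inv g _ ih =>
      obtain ⟨h, hh, h1⟩ := ih
      exact ⟨h⁻¹, inv_mem hh, fun v => by rw [Equiv.Perm.inv_eq_iff_eq, h1]; simp⟩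
  obtain ⟨h, hh, h1⟩ := base
  refine ⟨permB p ^ (x' : ℕ) * h * (permB p ^ (x : ℕ))⁻¹,
    mul_mem (mul_mem (pow_mem permB_mem _) hh) (inv_mem (pow_mem permB_mem _)), fun v => ?_⟩
  have h2 : (permB p ^ (x : ℕ))⁻¹ (x :: v) = ⟨0, hp⟩ :: v := by
    rw [Equiv.Perm.inv_eq_iff_eq, permB_cons_iterate hp x.2]
  rw [Equiv.Perm.mul_apply, Equiv.Perm.mul_apply, h2, h1, permB_cons_iterate hp x'.2]

theorem permA_eq_atLetter {x : Fin p} (hx : x.val + 1 = p) : permA p = atLetter x (permB p) := by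
  ext1 w
  cases w with
  | nil => rw [permA_nil, atLetter_nil]
  | cons y v =>
    rcases eq_or_ne y x with rfl | hy
    · rw [permA_cons, if_pos hx, atLetter_cons_self]
    · rw [permA_cons, if_neg fun hc => hy (Fin.ext (by omega)), atLetter_cons_of_ne hy]

/-- b acting below x is a conjugate of a, which is b acting below the last letter; hence its class
in the abelianisation is that of a. -/
theorem exists_atLetter_permB_mem_heisGraph (x : Fin p) :
    ∃ h, (atLetter x (permB p), h) ∈ heisGraph p ∧ h.x = 1 ∧ h.y = 0 := by
  have hp := x.pos
  obtain ⟨c, hc, h1⟩ := exists_lift (one_mem (permBasilica p)) ⟨p - 1, Nat.sub_lt hp one_pos⟩ x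
  obtain ⟨k, hk⟩ := exists_mem_heisGraph hc
  refine ⟨k * Heis.α * k⁻¹, ?_, by simp, by simp⟩
  have h2 := mul_mem (mul_mem hk permA_mem_heisGraph) (inv_mem hk)
  have h3 := conj_atLetter hp hc h1 (permB p)
  rw [one_mul, inv_one, mul_one, ← permA_eq_atLetter (by simp; omega)] at h3
  rw [← h3]
  exact h2

-- The derived subgroups and weak branching

/-- The derived subgroup of the `p`-Basilica group. -/
def derived (p : ℕ) : Subgroup (WordPerm p) := ⁅permBasilica p, permBasilica p⁆

/-- The second derived subgroup of the `p`-Basilica group. -/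
def derivedTwo (p : ℕ) : Subgroup (WordPerm p) := ⁅derived p, derived p⁆

/-- The permutations that lie in the second derived subgroup of the `p`-Basilica group when they
act below any letter. -/
def rigidPart (p : ℕ) : Subgroup (WordPerm p) := ⨅ x : Fin p, (derivedTwo p).comap (atLetter x)

theorem mem_rigidPart {t : WordPerm p} :
    t ∈ rigidPart p ↔ ∀ x : Fin p, atLetter x t ∈ derivedTwo p := by
  simp [rigidPart, Subgroup.mem_iInf]

theorem commutatorElement_mem_of_mem {Γ : Type*} [Group Γ] {H : Subgroup Γ} {g h : Γ}
    (hg : g ∈ H) (hh : h ∈ H) : ⁅g, h⁆ ∈ H :=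
  mul_mem (mul_mem (mul_mem hg hh) (inv_mem hg)) (inv_mem hh)

theorem commutator_self_le {Γ : Type*} [Group Γ] (H : Subgroup Γ) : ⁅H, H⁆ ≤ H := by
  rw [Subgroup.commutator_le]
  exact fun g hg h hh => commutatorElement_mem_of_mem hg hh

theorem derived_le : derived p ≤ permBasilica p := commutator_self_le _

theorem conj_mem_derived {g c : WordPerm p} (hg : g ∈ permBasilica p) (hc : c ∈ derived p) :
    g * c * g⁻¹ ∈ derived p :=
  conj_mem_commutator (fun _ hh => mul_mem (mul_mem hg hh) (inv_mem hg))
    (fun _ hh => mul_mem (mul_mem hg hh) (inv_mem hg)) hc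

theorem conj_mem_derivedTwo {g c : WordPerm p} (hg : g ∈ permBasilica p)
    (hc : c ∈ derivedTwo p) : g * c * g⁻¹ ∈ derivedTwo p :=
  conj_mem_commutator (fun _ hh => conj_mem_derived hg hh) (fun _ hh => conj_mem_derived hg hh) hc

theorem conj_mem_rigidPart {g c : WordPerm p} (hg : g ∈ permBasilica p)
    (hc : c ∈ rigidPart p) : g * c * g⁻¹ ∈ rigidPart p := by
  rw [mem_rigidPart] at hc ⊢
  intro x
  obtain ⟨h, hh, h1⟩ := exists_lift hg x x
  rw [← conj_atLetter x.pos hh h1]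
  exact conj_mem_derivedTwo hh (hc x)

/-- Commutator subgroups are compatible with both projections of the graph, so no uniqueness of
values is needed. -/
theorem exists_mem_heisGraph_of_mem_derived {g : WordPerm p} (hg : g ∈ derived p) :
    ∃ h, (g, h) ∈ heisGraph p ∧ h.x = 0 ∧ h.y = 0 := by
  rw [derived, ← map_fst_heisGraph, ← Subgroup.map_commutator] at hg
  obtain ⟨⟨g, h⟩, hr, rfl⟩ := hg
  have h1 : h ∈ (⁅heisGraph p, heisGraph p⁆).map (MonoidHom.snd _ _) := ⟨_, hr, rfl⟩
  rw [Subgroup.map_commutator] at h1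
  exact ⟨h, commutator_self_le _ hr, Heis.eq_of_mem_commutator h1⟩

theorem mem_heisGraph_of_mem_derivedTwo {g : WordPerm p} (hg : g ∈ derivedTwo p) :
    (g, 1) ∈ heisGraph p := by
  rw [derivedTwo, derived, ← map_fst_heisGraph, ← Subgroup.map_commutator,
    ← Subgroup.map_commutator] at hg
  obtain ⟨⟨g, h⟩, hr, rfl⟩ := hg
  have h1 : h ∈ (⁅⁅heisGraph p, heisGraph p⁆, ⁅heisGraph p, heisGraph p⁆⁆).map
    (MonoidHom.snd _ _) := ⟨_, hr, rfl⟩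
  rw [Subgroup.map_commutator, Subgroup.map_commutator, Heis.commutator_commutator_eq_bot,
    Subgroup.mem_bot] at h1
  subst h1
  exact commutator_self_le _ (commutator_self_le _ hr)

/-- The coordinates x, y are the exponent sums of a and b, and modulo G' the generators commute.
Hence G' is exactly the locus x = y = 0 (`mem_derived`). -/
theorem zpow_mul_zpow_mul_mem_derived {r : WordPerm p × Heis ℤ} (hr : r ∈ heisGraph p) :
    permB p ^ (-r.2.y) * permA p ^ (-r.2.x) * r.1 ∈ derived p := by
  induction hr using Subgroup.closure_induction_left with
  | one => simp
  | mul_left g hg r _ ih =>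
    rcases hg with rfl | rfl
    · have : permB p ^ (-(0 + r.2.y)) * permA p ^ (-(1 + r.2.x)) * (permA p * r.1) =
          permB p ^ (-r.2.y) * permA p ^ (-r.2.x) * r.1 := by group
      rw [← this] at ih
      exact ih
    · have h1 : ⁅permA p ^ (-r.2.x), permB p⁆ ∈ derived p :=
        Subgroup.commutator_mem_commutator (zpow_mem permA_mem _) permB_mem
      have h2 := conj_mem_derived (zpow_mem permB_mem (-(1 + r.2.y))) h1
      have : permB p ^ (-(1 + r.2.y)) * permA p ^ (-(0 + r.2.x)) * (permB p * r.1) =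
          permB p ^ (-(1 + r.2.y)) * ⁅permA p ^ (-r.2.x), permB p⁆ * (permB p ^ (-(1 + r.2.y)))⁻¹ *
            (permB p ^ (-r.2.y) * permA p ^ (-r.2.x) * r.1) := by
        simp only [commutatorElement_def]; group
      have h3 := mul_mem h2 ih
      rw [← this] at h3
      exact h3
  | inv_mul_cancel g hg r _ ih =>
    rcases hg with rfl | rfl
    · have : permB p ^ (-(-0 + r.2.y)) * permA p ^ (-(-1 + r.2.x)) * ((permA p)⁻¹ * r.1) =
          permB p ^ (-r.2.y) * permA p ^ (-r.2.x) * r.1 := by group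
      rw [← this] at ih
      exact ih
    · have h1 : ⁅permA p ^ (-r.2.x), (permB p)⁻¹⁆ ∈ derived p :=
        Subgroup.commutator_mem_commutator (zpow_mem permA_mem _) (inv_mem permB_mem)
      have h2 := conj_mem_derived (zpow_mem permB_mem (-(-1 + r.2.y))) h1
      have : permB p ^ (-(-1 + r.2.y)) * permA p ^ (-(-0 + r.2.x)) * ((permB p)⁻¹ * r.1) =
          permB p ^ (-(-1 + r.2.y)) * ⁅permA p ^ (-r.2.x), (permB p)⁻¹⁆ *
            (permB p ^ (-(-1 + r.2.y)))⁻¹ *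
            (permB p ^ (-r.2.y) * permA p ^ (-r.2.x) * r.1) := by
        simp only [commutatorElement_def]; group
      have h3 := mul_mem h2 ih
      rw [← this] at h3
      exact h3

theorem mem_derived {r : WordPerm p × Heis ℤ} (hr : r ∈ heisGraph p) (hx : r.2.x = 0)
    (hy : r.2.y = 0) : r.1 ∈ derived p := by
  simpa [hx, hy] using zpow_mul_zpow_mul_mem_derived hr

/-- Weak branching over G': [a, b] below x is the commutator of a lift of a with b acting below x,
both in G. Conjugation by lifts gives the rest of G'. -/
theorem atLetter_mem_derived (x : Fin p) {c : WordPerm p} (hc : c ∈ derived p) :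
    atLetter x c ∈ derived p := by
  have hp := x.pos
  obtain ⟨k, hk, -⟩ := exists_atLetter_permB_mem_heisGraph x
  have hb := fst_mem_of_mem_heisGraph hk
  have key : ⁅permA p, permB p⁆ ∈ (derived p).comap (atLetter x) := by
    obtain ⟨h, hh, h1⟩ := exists_lift permA_mem x x
    rw [Subgroup.mem_comap, commutatorElement_def, map_mul, ← conj_atLetter hp hh h1, map_inv]
    exact Subgroup.commutator_mem_commutator hh hb
  have hle : derived p ≤ (derived p).comap (atLetter x) := by
    refine commutator_closure_le (fun g hg m hm => ?_) ?_
    · obtain ⟨h, hh, h1⟩ := exists_lift hg x x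
      rw [Subgroup.mem_comap, ← conj_atLetter hp hh h1]
      exact conj_mem_derived hh hm
    · rintro _ (rfl | rfl) _ (rfl | rfl)
      · rw [commutatorElement_self]; exact one_mem _
      · exact key
      · rw [← commutatorElement_inv]; exact inv_mem key
      · rw [commutatorElement_self]; exact one_mem _
  exact hle hc

/-- a acts below the last letter and its conjugate by b below the first, so the two commute. -/
theorem commutator_permA_eq_one (hp : 1 < p) : ⁅permA p, ⁅permA p, permB p⁆⁆ = 1 := by
  have hp0 := zero_lt_one.trans hp
  have h1 := conj_atLetter hp0 (x := ⟨p - 1, Nat.sub_lt hp0 one_pos⟩) (x' := ⟨0, hp0⟩) permB_mem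
    (s := permA p) (fun v => by
      rw [permB_cons, if_pos (by simp; omega)]
      congr 1
      ext
      rw [finRotate_val, if_pos (by simp; omega)]) (permB p)
  have hA : permA p = atLetter ⟨p - 1, Nat.sub_lt hp0 one_pos⟩ (permB p) :=
    permA_eq_atLetter (by simp; omega)
  rw [← hA] at h1
  have h2 : Commute (permA p) (permB p * permA p * (permB p)⁻¹) := by
    rw [h1]
    nth_rewrite 1 [hA]
    exact commute_atLetter (by simp; omega) _ _
  rw [commutatorElement_eq_one_iff_commute]
  have h3 : ⁅permA p, permB p⁆ = permA p * (permB p * permA p * (permB p)⁻¹)⁻¹ := by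
    rw [commutatorElement_def]; group
  rw [h3]
  exact (Commute.refl _).mul_right h2.inv_right

theorem commutator_mem_derived : ⁅permA p, permB p⁆ ∈ derived p :=
  Subgroup.commutator_mem_commutator permA_mem permB_mem

/-- Write b_x for b acting below x. It is not in G', but b_x b_y⁻¹ is for y ≠ x, and b_y commutes
with everything acting below x. So [b_x, c] = [b_x b_y⁻¹, c] lies in G'' for c the copy of [a, b]
below x. -/
theorem commutator_permB_mem_rigidPart (hp : 1 < p) :
    ⁅permB p, ⁅permA p, permB p⁆⁆ ∈ rigidPart p := by
  rw [mem_rigidPart]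
  intro x
  have : Nontrivial (Fin p) := Fin.nontrivial_iff_two_le.2 hp
  obtain ⟨y, hy⟩ := exists_ne x
  obtain ⟨k, hk, hk1, hk2⟩ := exists_atLetter_permB_mem_heisGraph x
  obtain ⟨l, hl, hl1, hl2⟩ := exists_atLetter_permB_mem_heisGraph y
  have h1 : atLetter x (permB p) * (atLetter y (permB p))⁻¹ ∈ derived p :=
    mem_derived (mul_mem hk (inv_mem hl)) (by simp [hk1, hl1]) (by simp [hk2, hl2])
  have h2 := Subgroup.commutator_mem_commutator h1
    (atLetter_mem_derived x commutator_mem_derived)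
  have h3 : Commute (atLetter y (permB p))⁻¹ (atLetter x ⁅permA p, permB p⁆) :=
    (commute_atLetter hy _ _).inv_left
  have h4 : ∀ f g t : WordPerm p, Commute g t → ⁅f * g, t⁆ = ⁅f, t⁆ := by
    intro f g t h
    have h5 : ⁅f * g, t⁆ = f * ⁅g, t⁆ * f⁻¹ * ⁅f, t⁆ := by
      simp only [commutatorElement_def]; group
    rw [h5, commutatorElement_eq_one_iff_commute.2 h]
    group
  rw [h4 _ _ _ h3] at h2
  rw [map_commutatorElement]
  exact h2

/-- The copy of g below the letter 0 lies in G'', so its value under χ is trivial; the recursion,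
with a single nontrivial section, then reads off that g has trivial coordinates. -/
theorem snd_z_eq_zero_of_mem_rigidPart (hp : 1 < p) {g : WordPerm p} {h : Heis ℤ}
    (hg : g ∈ rigidPart p) (hr : (g, h) ∈ heisGraph p) : h.z = 0 := by
  have hp0 := zero_lt_one.trans hp
  have h1 := mem_heisGraph_of_mem_derivedTwo (mem_rigidPart.1 hg ⟨0, hp0⟩)
  rw [atLetter_apply] at h1
  obtain ⟨k, hk, hs⟩ := isSections_diag hp0 h1
  have hk0 : k ⟨0, hp0⟩ = h := by
    refine heisGraph_unique hp (hk ⟨0, hp0⟩) ?_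
    rwa [Pi.mulSingle_eq_same]
  have hk1 : ∀ x, x ≠ ⟨0, hp0⟩ → k x = 1 := by
    intro x hx
    refine heisGraph_unique hp (hk x) ?_
    rw [Pi.mulSingle_eq_of_ne hx]
    exact one_mem _
  have hx := hs.sec_x ⟨0, hp0⟩
  have hy := hs.x_eq
  have hz := hs.z_eq
  rw [Finset.sum_eq_single ⟨0, hp0⟩ (fun x _ hx => by simp [hk1 x hx]) (by simp)] at hy hz
  simp only [hk0, Heis.one_x, Heis.one_y, Heis.one_z] at hx hy hz
  rw [← hy, hx] at hz
  simpa [hp0.ne'] using hz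

-- Congruence inside the derived subgroup

/-- An element of G' is [a, b]^n up to `rigidPart p`, and its z-coordinate is n. Fixing level 3k
makes n divisible by p ^ k. -/
theorem derived_inf_wordStabilizer_le (hp : 1 < p) (k : ℕ) {N : Subgroup (WordPerm p)}
    (hpow : ∀ g ∈ derived p, g ^ p ^ k ∈ N) (hN : rigidPart p ≤ N) :
    derived p ⊓ wordStabilizer p (3 * k) ≤ N := by
  rintro g ⟨hg, hst⟩
  obtain ⟨h, hr, -, -⟩ := exists_mem_heisGraph_of_mem_derived hg
  have hdvd := (pow_dvd_of_mem_wordStabilizer (zero_lt_one.trans hp) k _ hr hst).2.2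
  obtain ⟨n, m, hm, rfl⟩ := exists_zpow_mul_of_mem_commutator (M := rigidPart p)
    (fun g hg m hm => conj_mem_rigidPart hg hm)
    (by rw [commutator_permA_eq_one hp]; exact one_mem _) (commutator_permB_mem_rigidPart hp) hg
  have hz1 : (⁅permA p, permB p⁆, ⁅(Heis.α : Heis ℤ), Heis.β⁆) ∈ heisGraph p :=
    commutatorElement_mem_of_mem permA_mem_heisGraph permB_mem_heisGraph
  have hz : (⁅permA p, permB p⁆ ^ n, ⁅(Heis.α : Heis ℤ), Heis.β⁆ ^ n) ∈ heisGraph p :=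
    zpow_mem hz1 n
  have hm' := mul_mem (inv_mem hz) hr
  rw [Prod.inv_mk, Prod.mk_mul_mk, inv_mul_cancel_left] at hm'
  have h1 := snd_z_eq_zero_of_mem_rigidPart hp hm hm'
  have h0 : (⁅(Heis.α : Heis ℤ), (Heis.β : Heis ℤ)⁆).x = 0 := by rw [Heis.commutatorElement_eq]
  have h2 : h.z = n := by
    rw [← zpow_neg, Heis.mul_z, Heis.zpow_z_of_x_eq_zero h0, Heis.zpow_x, h0,
      Heis.commutatorElement_eq] at h1
    simp at h1
    linarith
  rw [h2] at hdvd
  obtain ⟨n', rfl⟩ := hdvd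
  refine mul_mem ?_ (hN hm)
  have := hpow _ (zpow_mem commutator_mem_derived n')
  rw [← zpow_natCast, ← zpow_mul, mul_comm] at this
  exact_mod_cast this

theorem eq_diag {g : WordPerm p} (h0 : g [] = []) {t : Fin p → WordPerm p}
    (h : ∀ x v, g (x :: v) = x :: t x v) : g = diag p t := by
  ext1 w
  cases w with
  | nil => exact h0
  | cons x v => exact h x v

/-- By the recursion, x is the sum of the exponents and y is p times the x-coordinate of a power of
b; both vanish. -/
theorem diag_zpow_permB_mem_derived (hp : 1 < p) {c : Fin p → ℤ} (hc : ∑ x, c x = 0) :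
    diag p (fun x => permB p ^ c x) ∈ derived p := by
  have hp0 := zero_lt_one.trans hp
  have h1 : diag p (fun x => permB p ^ c x) ∈ permBasilica p := by
    refine diag_mem fun x => ?_
    rw [map_zpow]
    obtain ⟨k, hk, -⟩ := exists_atLetter_permB_mem_heisGraph x
    exact zpow_mem (fst_mem_of_mem_heisGraph hk) _
  obtain ⟨h, hr⟩ := exists_mem_heisGraph h1
  obtain ⟨k, hk, hs⟩ := isSections_diag hp0 hr
  have hk1 : ∀ x, k x = Heis.β ^ c x := fun x =>
    heisGraph_unique hp (hk x) (zpow_mem permB_mem_heisGraph (c x))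
  refine mem_derived hr ?_ ?_
  · rw [hs.x_eq, ← hc]
    refine Finset.sum_congr rfl fun x _ => ?_
    simp [hk1, Heis.zpow_y]
  · rw [hs.y_eq (x := ⟨0, hp0⟩) rfl]
    simp [hk1, Heis.zpow_x]

theorem zpow_mem_wordStabilizer {n : ℕ} {z : ℤ} (h : (p : ℤ) ^ n ∣ z) :
    permA p ^ z ∈ wordStabilizer p n ∧ permB p ^ z ∈ wordStabilizer p n := by
  obtain ⟨c, rfl⟩ := h
  have := pow_mem_wordStabilizer (p := p) n
  rw [zpow_mul, zpow_mul]
  exact ⟨zpow_mem (by exact_mod_cast this.1) c, zpow_mem (by exact_mod_cast this.2) c⟩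

/-- The sections of an element of G' have x = 0 and y-coordinates summing to zero. Dividing out the
powers of b leaves sections in G', and the divided part is a p^k-th power in G'. Of the 3(k + m) + 1
levels, one passes to the sections and the rest give p^(k+m) ∣ y: the factor p^k serves for the
power, p^m keeps the corrected sections in the level-m stabiliser. -/
theorem derived_inf_wordStabilizer_le_of_atLetter (hp : 1 < p) (k m : ℕ)
    {N : Subgroup (WordPerm p)} (hpow : ∀ g ∈ derived p, g ^ p ^ k ∈ N)
    (hN : ∀ x, derived p ⊓ wordStabilizer p m ≤ N.comap (atLetter x)) :
    derived p ⊓ wordStabilizer p (3 * (k + m) + 1) ≤ N := by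
  rintro g ⟨hg, hst⟩
  have hp0 := zero_lt_one.trans hp
  obtain ⟨h, hr, hx, hy⟩ := exists_mem_heisGraph_of_mem_derived hg
  obtain ⟨τ, s, hs⟩ := exists_isSections hp0 hr
  have h1 := hs.apply_eq_of_mem_wordStabilizer hst
  have hdvd := fun x => (pow_dvd_of_mem_wordStabilizer hp0 _ _ (hs.mem x) (h1 x).2).2.1
  have hsx : ∀ x, (s x).2.x = 0 := by
    intro x
    rw [hs.sec_x, hy, add_zero, Int.ediv_eq_zero_of_lt (by positivity) (by exact_mod_cast x.2)]
  have hsum : ∑ x, (s x).2.y = 0 := by rw [← hs.x_eq, hx]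
  have hsplit : g = diag p (fun x => (s x).1 * permB p ^ (-(s x).2.y)) *
      diag p (fun x => permB p ^ (s x).2.y) := by
    rw [← map_mul]
    refine eq_diag (apply_nil (derived_le hg)) fun x v => ?_
    rw [hs.apply, (h1 x).1]
    simp
  rw [hsplit]
  refine mul_mem (diag_mem fun x => hN x ⟨?_, ?_⟩) ?_
  · exact mem_derived (mul_mem (hs.mem x) (zpow_mem permB_mem_heisGraph (-(s x).2.y)))
      (by simp [hsx, Heis.zpow_x]) (by simp [Heis.zpow_y])
  · refine wordStabilizer_anti (Nat.le_add_left m k) (mul_mem ?_ ?_)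
    · exact wordStabilizer_anti (by omega) (h1 x).2
    · exact (zpow_mem_wordStabilizer ((dvd_neg).2 (hdvd x))).2
  · have hdvd' : ∀ x, ∃ c, (s x).2.y = c * (p : ℤ) ^ k := fun x => by
      obtain ⟨c, hc⟩ := (pow_dvd_pow (p : ℤ) (Nat.le_add_right k m)).trans (hdvd x)
      exact ⟨c, by rw [hc, mul_comm]⟩
    choose c hc using hdvd'
    have hcsum : ∑ x, c x = 0 := by
      have h2 : (∑ x, c x) * (p : ℤ) ^ k = 0 := by
        rw [Finset.sum_mul, ← hsum]
        exact Finset.sum_congr rfl fun x _ => (hc x).symm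
      exact (mul_eq_zero.1 h2).resolve_right (pow_ne_zero _ (by exact_mod_cast hp0.ne'))
    have h2 := hpow _ (diag_zpow_permB_mem_derived hp hcsum)
    rw [← map_pow] at h2
    convert h2 using 2
    funext x
    rw [Pi.pow_apply, hc, zpow_mul]
    exact_mod_cast rfl

-- Branching below arbitrary words

/-- The action on the words below the word `u`. -/
def atWord : List (Fin p) → WordPerm p →* WordPerm p
  | [] => MonoidHom.id _
  | x :: u => (atLetter x).comp (atWord u)

@[simp] theorem atWord_nil (t : WordPerm p) : atWord [] t = t := rfl

@[simp] theorem atWord_cons (x : Fin p) (u : List (Fin p)) (t : WordPerm p) :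
    atWord (x :: u) t = atLetter x (atWord u t) := rfl

theorem atWord_mem_derived (u : List (Fin p)) {c : WordPerm p} (hc : c ∈ derived p) :
    atWord u c ∈ derived p := by
  induction u with
  | nil => exact hc
  | cons x u ih => exact atLetter_mem_derived x ih

theorem commute_atWord {u u' : List (Fin p)} (hl : u.length = u'.length) (h : u ≠ u')
    (s t : WordPerm p) : Commute (atWord u s) (atWord u' t) := by
  induction u generalizing u' with
  | nil => exact absurd (List.length_eq_zero_iff.1 hl.symm).symm h
  | cons x u ih =>
    cases u' with
    | nil => simp at hl
    | cons x' u' =>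
      rcases eq_or_ne x x' with rfl | hx
      · exact (ih (by simpa using hl) (fun hc => h (by rw [hc]))).map (atLetter x)
      · exact commute_atLetter hx _ _

theorem exists_word_section (hp : 0 < p) (u : List (Fin p)) {g : WordPerm p}
    (hg : g ∈ permBasilica p) :
    ∃ s ∈ permBasilica p, (g u).length = u.length ∧ ∀ v, g (u ++ v) = g u ++ s v := by
  induction u generalizing g with
  | nil => exact ⟨g, hg, by rw [apply_nil hg], fun v => by rw [apply_nil hg]; rfl⟩
  | cons x u ih =>
    obtain ⟨τ, s, hs, h1⟩ := exists_sections hp hg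
    obtain ⟨t, ht, hl, h2⟩ := ih (hs x)
    exact ⟨t, ht, by simp [h1, hl], fun v => by simp [h1, h2]⟩

theorem exists_word_lift {u u' : List (Fin p)} (hl : u.length = u'.length) {g : WordPerm p}
    (hg : g ∈ permBasilica p) : ∃ h ∈ permBasilica p, ∀ v, h (u ++ v) = u' ++ g v := by
  induction u generalizing u' with
  | nil =>
    obtain rfl := List.length_eq_zero_iff.1 hl.symm
    exact ⟨g, hg, fun v => rfl⟩
  | cons x u ih =>
    cases u' with
    | nil => simp at hl
    | cons x' u' =>
      obtain ⟨h, hh, h1⟩ := ih (u' := u') (by simpa using hl)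
      obtain ⟨k, hk, h2⟩ := exists_lift hh x x'
      exact ⟨k, hk, fun v => by simp [h1, h2]⟩

theorem conj_atWord (hp : 0 < p) {h s : WordPerm p} (hh : h ∈ permBasilica p)
    {u u' : List (Fin p)} (hl : u.length = u'.length) (hs : ∀ v, h (u ++ v) = u' ++ s v)
    (t : WordPerm p) : h * atWord u t * h⁻¹ = atWord u' (s * t * s⁻¹) := by
  induction u generalizing u' h with
  | nil =>
    obtain rfl := List.length_eq_zero_iff.1 hl.symm
    obtain rfl : h = s := Equiv.ext hs
    rfl
  | cons x u ih =>
    cases u' with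
    | nil => simp at hl
    | cons x' u' =>
      obtain ⟨τ, σ, hσ, h1⟩ := exists_sections hp hh
      have h2 : ∀ v, τ x = x' ∧ σ x (u ++ v) = u' ++ s v := fun v => by
        have := hs v
        rw [List.cons_append, h1] at this
        simpa using this
      have h3 : ∀ v, h (x :: v) = x' :: σ x v := fun v => by rw [h1, (h2 []).1]
      rw [atWord_cons, conj_atLetter hp hh h3,
        ih (hσ x) (by simpa using hl) (fun v => (h2 v).2), atWord_cons]

/-- A subgroup that contains the second derived subgroup below all words of some length and all
`p ^ k`-th powers of elements of the derived subgroup contains the elements of the derived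
subgroup that fix a sufficiently high level. -/
theorem exists_derived_inf_wordStabilizer_le (hp : 1 < p) (k j : ℕ) :
    ∃ m, ∀ N : Subgroup (WordPerm p), (∀ g ∈ derived p, g ^ p ^ k ∈ N) →
      (∀ u : List (Fin p), u.length = j → derivedTwo p ≤ N.comap (atWord u)) →
      derived p ⊓ wordStabilizer p m ≤ N := by
  have hpow' : ∀ N : Subgroup (WordPerm p), (∀ g ∈ derived p, g ^ p ^ k ∈ N) →
      ∀ x, ∀ g ∈ derived p, g ^ p ^ k ∈ N.comap (atLetter x) := by
    intro N hpow x g hg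
    rw [Subgroup.mem_comap, map_pow]
    exact hpow _ (atLetter_mem_derived x hg)
  -- The bound m is chosen before N, because the inductive step applies it to the preimages of N
  -- under `atLetter x` for all letters x.
  induction j with
  | zero =>
    refine ⟨_, fun N hpow hN => derived_inf_wordStabilizer_le_of_atLetter hp k (3 * k) hpow
      fun x => derived_inf_wordStabilizer_le hp k (hpow' N hpow x) fun t ht => ?_⟩
    exact hN [] rfl (mem_rigidPart.1 ht x)
  | succ j ih =>
    obtain ⟨m, hm⟩ := ih
    refine ⟨_, fun N hpow hN => derived_inf_wordStabilizer_le_of_atLetter hp k m hpow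
      fun x => hm _ (hpow' N hpow x) fun u hu t ht => ?_⟩
    exact hN (x :: u) (by simp [hu]) ht

/-- A nontrivial normal subgroup contains the second derived subgroup below all words of some
length. -/
theorem exists_derivedTwo_le_comap_atWord (hp : 0 < p) {N : Subgroup (WordPerm p)}
    (hN : ∀ g ∈ permBasilica p, ∀ n ∈ N, g * n * g⁻¹ ∈ N) {n : WordPerm p} (hn : n ∈ N)
    (hnG : n ∈ permBasilica p) (hn1 : n ≠ 1) :
    ∃ j, ∀ u : List (Fin p), u.length = j → derivedTwo p ≤ N.comap (atWord u) := by
  obtain ⟨u, hu⟩ : ∃ u, n u ≠ u := by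
    by_contra! h
    exact hn1 (Equiv.ext h)
  obtain ⟨s, hs, hl, h1⟩ := exists_word_section hp u hnG
  have hu2 : derivedTwo p ≤ N.comap (atWord u) := by
    rw [derivedTwo, Subgroup.commutator_le]
    intro c hc d hd
    rw [Subgroup.mem_comap, map_commutatorElement]
    have hC := derived_le (atWord_mem_derived u hc)
    have hD := derived_le (atWord_mem_derived u hd)
    have h2 := conj_atWord hp hnG hl.symm h1 c⁻¹
    have h3 := commute_atWord hl hu (s * c⁻¹ * s⁻¹) d
    rw [← h2, map_inv] at h3
    generalize atWord u c = C at *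
    generalize atWord u d = D at *
    have h4 : C * n * C⁻¹ * n⁻¹ ∈ N := mul_mem (hN _ hC _ hn) (inv_mem hn)
    have h5 := mul_mem h4 (hN _ hD _ (inv_mem h4))
    -- Here n C⁻¹ n⁻¹ acts below n u, which differs from u, so it commutes with D. Therefore [[C,
    -- n], D] = [C, D], and the left side lies in N.
    have h6 : C * n * C⁻¹ * n⁻¹ * (D * (C * n * C⁻¹ * n⁻¹)⁻¹ * D⁻¹) =
        C * ((n * C⁻¹ * n⁻¹) * D) * (n * C⁻¹ * n⁻¹)⁻¹ * C⁻¹ * D⁻¹ := by group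
    rw [h6, h3.eq] at h5
    rw [commutatorElement_def]
    convert h5 using 1
    group
  refine ⟨u.length, fun u' hu' t ht => ?_⟩
  -- An element of G carrying u to u' with trivial section transports the copy of G'' from u to u'.
  obtain ⟨h, hh, h2⟩ := exists_word_lift hu'.symm (one_mem (permBasilica p))
  have h3 := conj_atWord hp hh hu'.symm h2 t
  rw [one_mul, inv_one, mul_one] at h3
  rw [Subgroup.mem_comap, ← h3]
  exact hN _ hh _ (hu2 ht)

-- The p-congruence subgroup property

/-- Pad a shorter word to length n; G preserves prefixes. This links the two forms of level
stabiliser. -/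
theorem mem_wordStabilizer_of_forall_length_eq (hp : 0 < p) {g : WordPerm p}
    (hg : g ∈ permBasilica p) {n : ℕ} (h : ∀ u : List (Fin p), u.length = n → g u = u) :
    g ∈ wordStabilizer p n := by
  intro u hu
  obtain ⟨s, -, hl, h1⟩ := exists_word_section hp u hg
  have h2 := h (u ++ List.replicate (n - u.length) ⟨0, hp⟩) (by simp; omega)
  rw [h1] at h2
  exact (List.append_inj h2 hl).1

theorem exists_wordStabilizer_le (hp : 1 < p) {k : ℕ} {N : Subgroup (WordPerm p)}
    (hN : ∀ g ∈ permBasilica p, ∀ n ∈ N, g * n * g⁻¹ ∈ N)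
    (hpow : ∀ g ∈ permBasilica p, g ^ p ^ k ∈ N) :
    ∃ m, permBasilica p ⊓ wordStabilizer p m ≤ N := by
  have hp0 := zero_lt_one.trans hp
  -- The x-coordinate of a^(p^k) is p^k, so N has a nontrivial element.
  have hA1 : permA p ^ p ^ k ≠ 1 := by
    intro h
    have h1 := snd_eq_one_of_fst_eq_one hp (pow_mem permA_mem_heisGraph (p ^ k)) h
    have h2 := congrArg Heis.x h1
    change ((Heis.α : Heis ℤ) ^ p ^ k).x = 0 at h2
    rw [Heis.pow_x] at h2
    simp [hp0.ne'] at h2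
  obtain ⟨j, hj⟩ := exists_derivedTwo_le_comap_atWord hp0 hN (hpow _ permA_mem)
    (pow_mem permA_mem _) hA1
  obtain ⟨m, hm⟩ := exists_derived_inf_wordStabilizer_le hp k j
  have hm := hm N (fun g hg => hpow g (derived_le hg)) hj
  refine ⟨3 * (k + m), ?_⟩
  rintro g ⟨hg, hst⟩
  obtain ⟨h, hr⟩ := exists_mem_heisGraph hg
  obtain ⟨hx, hy, -⟩ := pow_dvd_of_mem_wordStabilizer hp0 _ _ hr hst
  have hmem : ∀ f ∈ permBasilica p, ∀ z : ℤ, (p : ℤ) ^ (k + m) ∣ z → f ^ z ∈ N := by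
    intro f hf z hz
    obtain ⟨c, rfl⟩ := (pow_dvd_pow (p : ℤ) (Nat.le_add_right k m)).trans hz
    rw [zpow_mul]
    exact zpow_mem (by exact_mod_cast hpow f hf) c
  have h1 := zpow_mul_zpow_mul_mem_derived hr
  -- Correcting g by powers of a and b puts it in G'. Their exponents are divisible by p^(k+m), so
  -- these powers lie in N and also fix level m.
  have h2 : permB p ^ (-h.y) * permA p ^ (-h.x) * g ∈ N := by
    refine hm ⟨h1, wordStabilizer_anti (Nat.le_add_left m k) (mul_mem (mul_mem ?_ ?_) ?_)⟩
    · exact (zpow_mem_wordStabilizer (dvd_neg.2 hy)).2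
    · exact (zpow_mem_wordStabilizer (dvd_neg.2 hx)).1
    · exact wordStabilizer_anti (by omega) hst
  exact (Subgroup.mul_mem_cancel_left N (mul_mem (hmem _ permB_mem _ (dvd_neg.2 hy))
    (hmem _ permA_mem _ (dvd_neg.2 hx)))).1 h2

theorem hasPCongruenceSubgroupProperty (hp : 1 < p) :
    HasPCongruenceSubgroupProperty (basilica p) := by
  rintro N hN ⟨k, hk⟩
  let ι : basilica p →* WordPerm p := (toWordPerm p).comp (basilica p).subtype
  have hι : Function.Injective ι := toWordPerm_injective.comp Subtype.val_injective
  have hsurj : ∀ g ∈ permBasilica p, ∃ g', ι g' = g := by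
    intro g hg
    rw [← map_basilica] at hg
    obtain ⟨g, hg, rfl⟩ := hg
    exact ⟨⟨g, hg⟩, rfl⟩
  obtain ⟨m, hm⟩ := exists_wordStabilizer_le hp (k := k) (N := N.map ι)
    (by
      rintro g hg _ ⟨n, hn, rfl⟩
      obtain ⟨g, rfl⟩ := hsurj g hg
      exact ⟨g * n * g⁻¹, hN.conj_mem n hn g, by simp⟩)
    (by
      intro g hg
      obtain ⟨g, rfl⟩ := hsurj g hg
      refine ⟨g ^ p ^ k, ?_, map_pow ι g _⟩
      rw [← hk]
      -- The index enters only here: it makes all p^k-th powers lie in N.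
      exact N.pow_index_mem g)
  refine ⟨m, fun g hg => ?_⟩
  have hgG : ι g ∈ permBasilica p := toWordPerm_mem g.2
  obtain ⟨g', hg', h⟩ := hm ⟨hgG, mem_wordStabilizer_of_forall_length_eq
    (zero_lt_one.trans hp) hgG fun u hu => hg u hu⟩
  rwa [← hι h]

end PBasilica

theorem theorem1p2 (p : ℕ) (hp : p.Prime) :
    PBasilica.HasPCongruenceSubgroupProperty (PBasilica.basilica p) ∧
    ¬ PBasilica.HasCongruenceSubgroupProperty (PBasilica.basilica p) ∧
    ¬ PBasilica.HasWeakCongruenceSubgroupProperty (PBasilica.basilica p) ∧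
    ∀ q : ℕ, q.Prime → q ≠ p →
      ∃ (N : Subgroup (PBasilica.basilica p)) (_ : N.Normal),
        Nonempty ((PBasilica.basilica p ⧸ N) ≃* PBasilica.heisenberg (ZMod q)) ∧
        ∀ n : ℕ,
          ¬ ⁅PBasilica.levelStabilizerIn (PBasilica.basilica p) n,
              PBasilica.levelStabilizerIn (PBasilica.basilica p) n⁆ ≤ N :=
  ⟨PBasilica.hasPCongruenceSubgroupProperty hp.one_lt,
    PBasilica.not_hasCongruenceSubgroupProperty hp,
    PBasilica.not_hasWeakCongruenceSubgroupProperty hp,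
    fun _ hq hqp => PBasilica.exists_heisenberg_quotient hp hq hqp⟩
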